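/- Let $n\ge 2$. Then $\mathrm{Proj}^-_{\mathbb{R}^n}\equiv_{\mathrm{sW}}\mathrm{BWT}_{\mathbb{R}}$, that is, $\mathrm{Proj}^-_{\mathbb{R}^n}\le_{\mathrm{sW}}\mathrm{BWT}_{\mathbb{R}}$ and $\mathrm{BWT}_{\mathbb{R}}\le_{\mathrm{sW}}\mathrm{Proj}^-_{\mathbb{R}^n}$, with the following notions. A representation of a set $X$ is a surjective partial function $\delta_X:\subseteq\mathbb{N}^{\mathbb{N}}\to X$; $p$ is a name of $x$ if $\delta_X(p)=x$. Pairs and sequences are represented by $\langle p_0,p_1\rangle$ and $\langle p_0,p_1,\dots\rangle$, using the usual computable (un)pairing. A partial multi-valued function $f:\subseteq X\rightrightarrows Y$ assigns to each $x\in X$ a set $f(x)\subseteq Y$, and $\mathrm{dom}(f)=\{x: f(x)\neq\emptyset\}$. A partial function $F:\subseteq\mathbb{N}^{\mathbb{N}}\to\mathbb{N}^{\mathbb{N}}$ realizes $f$ between represented spaces if $\delta_Y(F(p))\in f(\delta_X(p))$ for every name $p$ of a point of $\mathrm{dom}(f)$. We write $f\le_{\mathrm{sW}}g$ if there are computable (by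 a type-two Turing machine) partial functions $H,K:\subseteq\mathbb{N}^{\mathbb{N}}\to\mathbb{N}^{\mathbb{N}}$ such that $K\circ G\circ H$ realizes $f$ whenever $G$ realizes $g$. $\mathbb{R}^m$ carries the Euclidean metric $d$ and an effective enumeration $\alpha:\mathbb{N}\to\mathbb{Q}^m$ of $\mathbb{Q}^m$. In the Cauchy representation, $p$ is a name of $x$ if $d(\alpha(p(i)),\alpha(p(j)))\le 2^{-i}$ for all $i\le j$ and $\lim_i\alpha(p(i))=x$. The space $\mathcal{A}_-(\mathbb{R}^m)$ is the set of closed subsets of $\mathbb{R}^m$, where $p$ is a name of $A$ if $A=\mathbb{R}^m\setminus\bigcup_i B_{p(i)}$; here $B_{\langle k,l\rangle}=B(\alpha(k),q_l)$ is an open ball and $(q_l)_l$ is an effective enumeration of the nonnegative rationals. $\mathrm{Proj}^-_{\mathbb{R}^n}:\subseteq\mathbb{R}^n\times\mathcal{A}_-(\mathbb{R}^n)\rightrightarrows\mathbb{R}^n$ maps $(x,A)$ with $A\ne\emptyset$ to $\{y\in A: d(x,y)=\inf_{z\in A}d(x,z)\}$. $\mathrm{BWT}_{\mathbb{R}}:\subseteq\mathbb{R}^{\mathbb{N}}\rightrightarrows\mathbb{R}$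 maps each sequence whose range has compact closure to the set of its accumulation points, that is, the limits of its convergent subsequences. -/

import Mathlib

open Filter Topology TopologicalSpace

/-! ### Type-two computability on Baire space `ℕ → ℕ` -/

/-- A type-two machine (transducer on infinite sequences).  It reads its input sequence one symbol
after another; on reading a symbol it carries out a terminating computation that updates its memory
(an arbitrary effectively coded object) and appends a finite, possibly empty, word to its one-way
output tape.  Output that has been written is never revised. -/
structure TypeTwoMachine where
  State : Type
  [primcodable : Primcodable State]
  init : State
  step : State → ℕ → State × List ℕ
  computable_step : Computable₂ step

namespace TypeTwoMachine

/-- Memory and output tape of `M` after it has read the first `k` symbols of `p`. -/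
def config (M : TypeTwoMachine) (p : ℕ → ℕ) : ℕ → M.State × List ℕ
  | 0 => (M.init, [])
  | k + 1 =>
    ((M.step (M.config p k).1 (p k)).1, (M.config p k).2 ++ (M.step (M.config p k).1 (p k)).2)

/-- On input `p` the machine `M` writes, in the long run, the infinite sequence `q`: every symbol
of `q` is eventually written at its place.  (The tape only grows, so `q` is unique.) -/
def Produces (M : TypeTwoMachine) (p q : ℕ → ℕ) : Prop :=
  ∀ n, ∃ k, (M.config p k).2[n]? = some (q n)

end TypeTwoMachine

/-- A partial function on Baire space is computable if some type-two machine produces `F p` on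
every input `p` in the domain of `F`. -/
def BaireComputable (F : (ℕ → ℕ) →. (ℕ → ℕ)) : Prop :=
  ∃ M : TypeTwoMachine, ∀ p, ∀ q ∈ F p, M.Produces p q

/-! ### Represented spaces -/

/-- A representation of `X`: a surjective partial function from Baire space to `X`, given by its
graph; `IsName p x` says that `p` is a name of `x`. -/
structure BaireRepresentation (X : Type*) where
  IsName : (ℕ → ℕ) → X → Prop
  unique : ∀ {p x y}, IsName p x → IsName p y → x = y
  surjective : ∀ x, ∃ p, IsName p x

namespace BaireRepresentation

/-- Product representation: `⟨p₀, p₁⟩(2 i) = p₀(i)` and `⟨p₀, p₁⟩(2 i + 1) = p₁(i)`. -/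
def prod {X Y : Type*} (δ : BaireRepresentation X) (ε : BaireRepresentation Y) :
    BaireRepresentation (X × Y) where
  IsName p z := δ.IsName (fun i => p (2 * i)) z.1 ∧ ε.IsName (fun i => p (2 * i + 1)) z.2
  unique h h' := Prod.ext (δ.unique h.1 h'.1) (ε.unique h.2 h'.2)
  surjective z := by
    obtain ⟨p, hp⟩ := δ.surjective z.1
    obtain ⟨q, hq⟩ := ε.surjective z.2
    refine ⟨fun i => if i % 2 = 0 then p (i / 2) else q (i / 2), ?_, ?_⟩
    · convert hp using 1
      funext i
      simp
    · convert hq using 1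
      funext i
      have h1 : (2 * i + 1) % 2 = 1 := by omega
      have h2 : (2 * i + 1) / 2 = i := by omega
      simp [h1, h2]

/-- Representation of sequences: `⟨p₀, p₁, …⟩⟨i, j⟩ = pᵢ(j)`. -/
def seq {X : Type*} (δ : BaireRepresentation X) : BaireRepresentation (ℕ → X) where
  IsName p s := ∀ i, δ.IsName (fun j => p (Nat.pair i j)) (s i)
  unique h h' := funext fun i => δ.unique (h i) (h' i)
  surjective s := by
    choose p hp using fun i => δ.surjective (s i)
    exact ⟨fun k => p k.unpair.1 k.unpair.2, fun i => by simpa using hp i⟩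

end BaireRepresentation

/-! ### Partial multi-valued functions and strong Weihrauch reducibility -/

/-- A partial multi-valued function between represented spaces; `x` belongs to its domain
if and only if `sol x` is nonempty. -/
structure Problem where
  Input : Type
  Output : Type
  inRep : BaireRepresentation Input
  outRep : BaireRepresentation Output
  sol : Input → Set Output

/-- `F` is a realizer of `f`: it maps every name of every `x ∈ dom f` to a name of some
element of `f(x)`. -/
def Problem.Realizes (f : Problem) (F : (ℕ → ℕ) →. (ℕ → ℕ)) : Prop :=
  ∀ p x, f.inRep.IsName p x → (f.sol x).Nonempty →
    ∃ q ∈ F p, ∃ y ∈ f.sol x, f.outRep.IsName q y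

/-- Strong Weihrauch reducibility `f ≤ g`: there are computable `H`, `K` such that `K ∘ G ∘ H`
realizes `f` whenever `G` realizes `g`. -/
def StrongWeihrauchReducible (f g : Problem) : Prop :=
  ∃ H K : (ℕ → ℕ) →. (ℕ → ℕ), BaireComputable H ∧ BaireComputable K ∧
    ∀ G : (ℕ → ℕ) →. (ℕ → ℕ), g.Realizes G → f.Realizes (K.comp (G.comp H))

/-- Strong Weihrauch equivalence. -/
def StrongWeihrauchEquiv (f g : Problem) : Prop :=
  StrongWeihrauchReducible f g ∧ StrongWeihrauchReducible g f

/-! ### Metric spaces with a dense sequence: points and closed sets -/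

noncomputable section

/-- An explicit enumeration of the nonnegative rational numbers. -/
def nnratEnum (m : ℕ) : ℚ := (m.unpair.1 : ℚ) / ((m.unpair.2 : ℚ) + 1)

/-- An explicit enumeration of the rational numbers: `⟨⟨a, b⟩, c⟩ ↦ (a - b) / (c + 1)`. -/
def ratEnum (m : ℕ) : ℚ :=
  ((m.unpair.1.unpair.1 : ℚ) - (m.unpair.1.unpair.2 : ℚ)) / ((m.unpair.2 : ℚ) + 1)

theorem nnratEnum_surj (q : ℚ) (hq : 0 ≤ q) : ∃ m, nnratEnum m = q := by
  refine ⟨Nat.pair q.num.toNat (q.den - 1), ?_⟩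
  have hd : ((q.den - 1 : ℕ) : ℚ) + 1 = q.den := by
    have := q.den_pos
    exact_mod_cast Nat.sub_add_cancel this
  have hn : ((q.num.toNat : ℕ) : ℚ) = q.num := by
    exact_mod_cast Int.toNat_of_nonneg (Rat.num_nonneg.mpr hq)
  simp only [nnratEnum, Nat.unpair_pair]
  rw [hd, hn, Rat.num_div_den]

theorem ratEnum_surj (q : ℚ) : ∃ m, ratEnum m = q := by
  refine ⟨Nat.pair (Nat.pair q.num.toNat (-q.num).toNat) (q.den - 1), ?_⟩
  have hd : ((q.den - 1 : ℕ) : ℚ) + 1 = q.den := by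
    have := q.den_pos
    exact_mod_cast Nat.sub_add_cancel this
  have hn : ((q.num.toNat : ℕ) : ℚ) - (((-q.num).toNat : ℕ) : ℚ) = q.num := by
    exact_mod_cast Int.toNat_sub_toNat_neg q.num
  simp only [ratEnum, Nat.unpair_pair]
  rw [hd, hn, Rat.num_div_den]

/-- A dense sequence in a metric space, the datum from which names of points and of closed sets are
formed.  (For the spaces `ℝ` and `ℝⁿ` below, with explicit enumerations of `ℚ` and `ℚⁿ`, the distances
of its points are a computable double sequence, so these are computable metric spaces.) -/
structure DenseSequence (X : Type*) [MetricSpace X] where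
  pt : ℕ → X
  dense : DenseRange pt

namespace DenseSequence

variable {X : Type*} [MetricSpace X] (α : DenseSequence X)

/-- The Cauchy representation: `p` is a name of `x` if `(α(p i))ᵢ` is an effective Cauchy
sequence with limit `x`. -/
def cauchyRep : BaireRepresentation X where
  IsName p x := (∀ i j, i ≤ j → dist (α.pt (p i)) (α.pt (p j)) ≤ (2 : ℝ)⁻¹ ^ i) ∧
    Tendsto (fun i => α.pt (p i)) atTop (𝓝 x)
  unique h h' := tendsto_nhds_unique h.2 h'.2
  surjective x := by
    have hpos : ∀ i : ℕ, (0 : ℝ) < (2 : ℝ)⁻¹ ^ (i + 1) := fun i => by positivity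
    choose p hp using fun i : ℕ => α.dense.exists_dist_lt x (hpos i)
    refine ⟨p, fun i j hij => ?_, ?_⟩
    · have h1 := dist_triangle_left (α.pt (p i)) (α.pt (p j)) x
      have h2 : (2 : ℝ)⁻¹ ^ (j + 1) ≤ (2 : ℝ)⁻¹ ^ (i + 1) :=
        pow_le_pow_of_le_one (by norm_num) (by norm_num) (by omega)
      have h3 : (2 : ℝ)⁻¹ ^ (i + 1) + (2 : ℝ)⁻¹ ^ (i + 1) = (2 : ℝ)⁻¹ ^ i := by
        rw [pow_succ]; ring
      linarith [hp i, hp j]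
    · rw [tendsto_iff_dist_tendsto_zero]
      have hlim : Tendsto (fun i : ℕ => (2 : ℝ)⁻¹ ^ (i + 1)) atTop (𝓝 0) :=
        (tendsto_pow_atTop_nhds_zero_of_lt_one (by norm_num) (by norm_num)).comp
          (tendsto_add_atTop_nat 1)
      refine squeeze_zero (fun _ => dist_nonneg) (fun i => ?_) hlim
      rw [dist_comm]
      exact (hp i).le

/-- The basic open balls: `B_⟨n, m⟩ = B(α(n), q_m)`, where `q` enumerates the nonnegative
rationals. -/
def basicBall (k : ℕ) : Set X := Metric.ball (α.pt k.unpair.1) (nnratEnum k.unpair.2 : ℝ)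

theorem exists_basicBall {U : Set X} (hU : IsOpen U) {x : X} (hx : x ∈ U) :
    ∃ k, x ∈ α.basicBall k ∧ α.basicBall k ⊆ U := by
  obtain ⟨ε, hε, hb⟩ := Metric.isOpen_iff.mp hU x hx
  obtain ⟨r, hr0, hr⟩ := exists_rat_btwn (half_pos hε)
  have hr0' : (0 : ℚ) ≤ r := by exact_mod_cast hr0.le
  obtain ⟨n, hn⟩ := α.dense.exists_dist_lt x hr0
  obtain ⟨m, hm⟩ := nnratEnum_surj r hr0'
  refine ⟨Nat.pair n m, ?_, fun y hy => hb ?_⟩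
  · simpa [basicBall, hm] using hn
  · have hy' : dist y (α.pt n) < r := by simpa [basicBall, hm] using hy
    have := dist_triangle_right y x (α.pt n)
    rw [Metric.mem_ball]
    linarith

/-- Negative information on closed sets: `p` is a name of `A` if `A` is the complement of the
union of the basic open balls `B_{p(i)}`. -/
def negRep : BaireRepresentation (Closeds X) where
  IsName p A := (A : Set X) = (⋃ i, α.basicBall (p i))ᶜ
  unique h h' := SetLike.coe_injective (h.trans h'.symm)
  surjective A := by
    classical
    obtain ⟨z, hz⟩ := nnratEnum_surj 0 le_rfl
    have hempty : α.basicBall (Nat.pair 0 z) = ∅ := by simp [basicBall, hz]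
    refine ⟨fun k => if α.basicBall k ⊆ (A : Set X)ᶜ then k else Nat.pair 0 z, ?_⟩
    rw [eq_compl_comm]
    apply Set.Subset.antisymm
    · refine Set.iUnion_subset fun k => ?_
      by_cases h : α.basicBall k ⊆ (A : Set X)ᶜ
      · simpa only [if_pos h] using h
      · simp only [if_neg h, hempty, Set.empty_subset]
    · intro x hx
      obtain ⟨k, hk, hsub⟩ := α.exists_basicBall A.isClosed.isOpen_compl hx
      refine Set.mem_iUnion.mpr ⟨k, ?_⟩
      simpa only [if_pos hsub] using hk

end DenseSequence

/-- The exact negative projection operator `X × 𝒜₋(X) ⇉ X`: a point `x` (with its Cauchy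
representation) and a nonempty closed set `A` (with negative information) are mapped to the points
`y ∈ A` with `d(x, y) = d(x, A)`. -/
def projNeg {X : Type} [MetricSpace X] (α : DenseSequence X) : Problem where
  Input := X × Closeds X
  Output := X
  inRep := α.cauchyRep.prod α.negRep
  outRep := α.cauchyRep
  sol z := {y | y ∈ z.2 ∧ dist z.1 y = Metric.infDist z.1 (z.2 : Set X)}

/-- The Bolzano-Weierstrass operator `X^ℕ ⇉ X`: a sequence whose range is relatively compact is
mapped to its accumulation (cluster) points. -/
def BWT {X : Type} [MetricSpace X] (α : DenseSequence X) : Problem where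
  Input := ℕ → X
  Output := X
  inRep := α.cauchyRep.seq
  outRep := α.cauchyRep
  sol s := {y | IsCompact (closure (Set.range s)) ∧ MapClusterPt y atTop s}

/-! ### The computable metric spaces `ℝ` and `ℝⁿ` -/

/-- `ℝ` with the enumeration of `ℚ`. -/
def realSeq : DenseSequence ℝ where
  pt k := (ratEnum k : ℝ)
  dense := by
    have h : Function.Surjective ratEnum := ratEnum_surj
    exact Rat.denseRange_cast.comp h.denseRange Rat.continuous_coe_real

/-- The `i`-th entry of the sequence coded by `k = ⟨k₀, ⟨k₁, ⟨k₂, …⟩⟩⟩`. -/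
def tupleEntry (k : ℕ) : ℕ → ℕ
  | 0 => k.unpair.1
  | i + 1 => tupleEntry k.unpair.2 i

theorem tupleEntry_surj (n : ℕ) (f : ℕ → ℕ) : ∃ k, ∀ i < n, tupleEntry k i = f i := by
  induction n generalizing f with
  | zero => exact ⟨0, fun i hi => absurd hi (Nat.not_lt_zero i)⟩
  | succ n ih =>
    obtain ⟨k, hk⟩ := ih fun i => f (i + 1)
    refine ⟨Nat.pair (f 0) k, fun i hi => ?_⟩
    cases i with
    | zero => simp [tupleEntry]
    | succ i => simpa [tupleEntry] using hk i (by omega)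

/-- `ℝⁿ` with the Euclidean metric and the enumeration of `ℚⁿ` induced by that of `ℚ`. -/
def euclideanSeq (n : ℕ) : DenseSequence (EuclideanSpace ℝ (Fin n)) where
  pt k := WithLp.toLp 2 fun i => (ratEnum (tupleEntry k i) : ℝ)
  dense := by
    have h1 : DenseRange (fun (q : Fin n → ℚ) (i : Fin n) => (q i : ℝ)) :=
      DenseRange.piMap fun _ => Rat.denseRange_cast
    have h2 : Function.Surjective
        (fun (k : ℕ) (i : Fin n) => ratEnum (tupleEntry k i)) := by
      intro q
      choose g hg using fun i : Fin n => ratEnum_surj (q i)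
      obtain ⟨k, hk⟩ := tupleEntry_surj n fun i => if h : i < n then g ⟨i, h⟩ else 0
      refine ⟨k, funext fun i => ?_⟩
      simp [hk i i.2, hg]
    have h3 : DenseRange (WithLp.toLp 2 : (Fin n → ℝ) → EuclideanSpace ℝ (Fin n)) :=
      (WithLp.toLp_surjective 2).denseRange
    have h4 := h1.comp h2.denseRange (by fun_prop)
    exact h3.comp h4 (PiLp.continuous_toLp 2 _)

end

/-! In both reductions the two functionals are total, and the outer one sees only the answer of the
oracle, as strong reducibility requires. It is the first coordinate in one direction and a fixed
computable curve in the other.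

`bwt_reducible_projNeg`: accumulation points are described as minimisers of a function that can be
approximated from below. For each rational test interval and each index `τ`, take a weighted tent
over the interval, and replace it by the constant 1 once a term of index at least `τ` is seen in the
interval. Tents are at most 1, so the sum `P` only grows while the name is being read. At an
accumulation point every tent that survives vanishes; at any other point some surviving tent is
positive. Thus `P(c) ≤ P(c')` with `c'` an accumulation point forces `c` to be one
(`mapClusterPt_of_limitPenalty_le`). Let `V` be the supremum of the squares of the rationals in the
name, which compactness makes finite. The set `A = {z | V + P(z₀) ≤ ‖z‖²}` is closed, and balls in
its complement can be enumerated (`iUnion_basicBall_accumulationToProj`). If `c` is an accumulation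
point, then `c² ≤ V`, so a second coordinate suffices to find `z ∈ A` with `z₀ = c` and `‖z‖² = V +
P(c)`. A point `y` of `A` nearest to the origin therefore satisfies `V + P(y₀) ≤ ‖y‖² ≤ V + P(c)`,
and `y₀` is an accumulation point.

`projNeg_reducible_bwt`: a Schoenberg curve, rescaled on each `[N, N + 1]` so as to reach a cube of
side `2N`, reduces the search for a point of `ℝⁿ` to the search for one real parameter. At level
`k`, finitely many rational parameters are compared by exact arithmetic: those whose curve point
stays out of the first `k` balls up to `1/(k + 1)` compete for the smallest distance to the `k`-th
approximation of `x`. Every point of `A` is approximated by such competitors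
(`eventually_exists_admissible`). A bound of the parameter by the norm of its curve point keeps the
winners bounded. If `t` is an accumulation point of the winners, continuous convergence of the
approximating curves puts the curve point of `t` in `A`, at distance at most that of any given
nearest point. -/

/-! ### Functionals that read a computable amount of input -/

/-- The first `k` symbols of a sequence. -/
def initialWord (p : ℕ → ℕ) (k : ℕ) : List ℕ := (List.range k).map p

theorem initialWord_length (p : ℕ → ℕ) (k : ℕ) : (initialWord p k).length = k := by
  simp [initialWord]

theorem initialWord_succ (p : ℕ → ℕ) (k : ℕ) :
    initialWord p (k + 1) = initialWord p k ++ [p k] := by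
  simp [initialWord, List.range_succ]

theorem initialWord_getD (p : ℕ → ℕ) {k e : ℕ} (h : e < k) : (initialWord p k).getD e 0 = p e := by
  simp [initialWord, List.getD, h]

theorem initialWord_take (p : ℕ → ℕ) {k e : ℕ} (h : e ≤ k) :
    (initialWord p k).take e = initialWord p e := by
  simp [initialWord, ← List.map_take, List.take_range, h]

/-! ### A transducer driven by a primitive recursive function -/

/-- The machine that stores everything it has read and writes its `m`-th symbol as soon as
`h` applied to the stored word and `m` yields one. -/
def wordMachine (h : List ℕ × ℕ → Option ℕ) (hh : Primrec h) : TypeTwoMachine where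
  State := List ℕ × ℕ
  init := ([], 0)
  step s a := ((s.1 ++ [a], s.2 + (h (s.1 ++ [a], s.2)).toList.length),
    (h (s.1 ++ [a], s.2)).toList)
  computable_step := by
    have h1 : Primrec fun x : (List ℕ × ℕ) × ℕ => x.1.1 ++ [x.2] :=
      Primrec.list_concat.comp (Primrec.fst.comp Primrec.fst) Primrec.snd
    have h2 : Primrec fun x : (List ℕ × ℕ) × ℕ => x.1.2 := Primrec.snd.comp Primrec.fst
    have h3 : Primrec fun x : (List ℕ × ℕ) × ℕ => (h (x.1.1 ++ [x.2], x.1.2)).toList :=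
      Primrec.optionToList.comp (hh.comp (h1.pair h2))
    exact ((h1.pair (Primrec.nat_add.comp h2 (Primrec.list_length.comp h3))).pair h3).to_comp

theorem wordMachine_config (h : List ℕ × ℕ → Option ℕ) (hh : Primrec h) (p q : ℕ → ℕ)
    (hq : ∀ k m v, h (initialWord p k, m) = some v → v = q m) (k : ℕ) :
    ∃ c, (wordMachine h hh).config p k = ((initialWord p k, c), initialWord q c) := by
  induction k with
  | zero => exact ⟨0, rfl⟩
  | succ k ih =>
    obtain ⟨c, hc⟩ := ih
    have key : (wordMachine h hh).config p (k + 1) =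
      ((initialWord p (k + 1), c + (h (initialWord p (k + 1), c)).toList.length),
        initialWord q c ++ (h (initialWord p (k + 1), c)).toList) := by
      rw [TypeTwoMachine.config, hc, initialWord_succ]
      rfl
    cases hv : h (initialWord p (k + 1), c) with
    | none => exact ⟨c, by rw [key, hv, Option.toList_none, List.append_nil]; rfl⟩
    | some v =>
      refine ⟨c + 1, ?_⟩
      rw [key, initialWord_succ q, ← hq _ _ _ hv, hv]
      rfl

/-- Symbol `m` has to wait for all earlier ones. Hence `h` must be defined at all late stages, not
just at one stage, which might pass before the output counter reaches `m`. -/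
theorem wordMachine_produces (h : List ℕ × ℕ → Option ℕ) (hh : Primrec h) (p q : ℕ → ℕ)
    (hq : ∀ k m v, h (initialWord p k, m) = some v → v = q m)
    (hev : ∀ m, ∃ k₀, ∀ k ≥ k₀, (h (initialWord p k, m)).isSome) :
    (wordMachine h hh).Produces p q := by
  have step : ∀ k c, (wordMachine h hh).config p k = ((initialWord p k, c), initialWord q c) →
      ∃ c', (wordMachine h hh).config p (k + 1) =
        ((initialWord p (k + 1), c'), initialWord q c') ∧
        ((h (initialWord p (k + 1), c)).isSome → c < c') := by
    intro k c hc
    obtain ⟨c', hc'⟩ := wordMachine_config h hh p q hq (k + 1)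
    refine ⟨c', hc', fun hs => ?_⟩
    have key := hc'
    rw [TypeTwoMachine.config, hc] at key
    have h2 := congrArg (fun x => x.1.2) key
    obtain ⟨v, hv⟩ := Option.isSome_iff_exists.mp hs
    have : c + (h (initialWord p k ++ [p k], c)).toList.length = c' := h2
    rw [← initialWord_succ, hv] at this
    simp at this
    omega
  have mono : ∀ k c, (wordMachine h hh).config p k = ((initialWord p k, c), initialWord q c) →
      ∀ k' ≥ k, ∃ c' ≥ c,
        (wordMachine h hh).config p k' = ((initialWord p k', c'), initialWord q c') := by
    intro k c hc k' hk'
    induction k', hk' using Nat.le_induction with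
    | base => exact ⟨c, le_rfl, hc⟩
    | succ k' _ ih =>
      obtain ⟨c', h1, h2⟩ := ih
      obtain ⟨c'', h3⟩ := wordMachine_config h hh p q hq (k' + 1)
      refine ⟨c'', ?_, h3⟩
      have key := h3
      rw [TypeTwoMachine.config, h2] at key
      have h4 : c' + (h (initialWord p k' ++ [p k'], c')).toList.length = c'' :=
        congrArg (fun x => x.1.2) key
      omega
  have reach : ∀ m, ∃ k, ∃ c ≥ m,
      (wordMachine h hh).config p k = ((initialWord p k, c), initialWord q c) := by
    intro m
    induction m with
    | zero => exact ⟨0, 0, le_rfl, rfl⟩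
    | succ m ih =>
      obtain ⟨k, c, hc, hk⟩ := ih
      rcases hc.lt_or_eq with hlt | rfl
      · exact ⟨k, c, hlt, hk⟩
      -- At stage `max k k₀` the counter is already past `m`, or the next symbol read makes it
      -- advance.
      obtain ⟨k₀, hk₀⟩ := hev m
      obtain ⟨c', hc', hcfg⟩ := mono k m hk (max k k₀) (le_max_left _ _)
      obtain ⟨c'', hcfg', hlt⟩ := step _ _ hcfg
      rcases hc'.lt_or_eq with hlt' | rfl
      · exact ⟨_, c', hlt', hcfg⟩
      exact ⟨_, c'', hlt (hk₀ _ (le_trans (le_max_right _ _) (Nat.le_succ _))), hcfg'⟩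
  intro m
  obtain ⟨k, c, hc, hk⟩ := reach (m + 1)
  refine ⟨k, ?_⟩
  rw [hk]
  have : m < c := hc
  simp [initialWord, this]

/-- A functional is computable if its `m`-th output symbol is obtained primitive recursively from
a finite initial segment of the input whose length is primitive recursive in `m` and the first input
symbol. -/
theorem baireComputable_lift_of_initialWord {len : ℕ → ℕ → ℕ} {g : ℕ → List ℕ → ℕ}
    (hlen : Primrec₂ len) (hg : Primrec₂ g) :
    BaireComputable (PFun.lift fun p m => g m (initialWord p (len m (p 0)))) := by
  let h : List ℕ × ℕ → Option ℕ := fun x =>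
    if 1 ≤ x.1.length ∧ len x.2 (x.1.getD 0 0) ≤ x.1.length then
      some (g x.2 (x.1.take (len x.2 (x.1.getD 0 0)))) else none
  have hl : Primrec fun x : List ℕ × ℕ => len x.2 (x.1.getD 0 0) :=
    hlen.comp Primrec.snd ((Primrec.list_getD 0).comp Primrec.fst (Primrec.const 0))
  have hh : Primrec h := by
    refine Primrec.ite (PrimrecPred.and ?_ ?_) ?_ (Primrec.const _)
    · exact Primrec.nat_le.comp (Primrec.const 1) (Primrec.list_length.comp Primrec.fst)
    · exact Primrec.nat_le.comp hl (Primrec.list_length.comp Primrec.fst)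
    · exact Primrec.option_some.comp
        (hg.comp Primrec.snd (Primrec.list_take.comp hl Primrec.fst))
  refine ⟨wordMachine h hh, fun p q hq => ?_⟩
  obtain rfl : q = _ := Part.mem_some_iff.mp hq
  have hval : ∀ k m, 1 ≤ k → len m (p 0) ≤ k →
      h (initialWord p k, m) = some (g m (initialWord p (len m (p 0)))) := by
    intro k m hk hk'
    simp only [h, initialWord_length, initialWord_getD p (show 0 < k from hk), hk, hk', and_self,
      if_true, initialWord_take p hk']
  apply wordMachine_produces
  · intro k m v hv
    by_cases hc : 1 ≤ k ∧ len m (p 0) ≤ k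
    · rw [hval k m hc.1 hc.2] at hv
      exact (Option.some_injective _ hv).symm
    · exfalso
      simp only [h, initialWord_length] at hv
      by_cases hk : 1 ≤ k
      · rw [initialWord_getD p (show 0 < k from hk), if_neg hc] at hv
        cases hv
      · rw [if_neg (fun h' => hk h'.1)] at hv
        cases hv
  · intro m
    refine ⟨max 1 (len m (p 0)), fun k hk => ?_⟩
    rw [hval k m (le_trans (le_max_left _ _) hk) (le_trans (le_max_right _ _) hk)]
    rfl

/-- Strong reducibility through total computable functionals. -/
theorem StrongWeihrauchReducible.of_lift {f g : Problem} {H K : (ℕ → ℕ) → (ℕ → ℕ)}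
    (hH : BaireComputable (PFun.lift H)) (hK : BaireComputable (PFun.lift K))
    (h : ∀ p x, f.inRep.IsName p x → (f.sol x).Nonempty →
      ∃ x', g.inRep.IsName (H p) x' ∧ (g.sol x').Nonempty ∧
        ∀ q y', y' ∈ g.sol x' → g.outRep.IsName q y' → ∃ y ∈ f.sol x, f.outRep.IsName (K q) y) :
    StrongWeihrauchReducible f g := by
  refine ⟨_, _, hH, hK, fun G hG p x hp hx => ?_⟩
  obtain ⟨x', h1, h2, h3⟩ := h p x hp hx
  obtain ⟨q, hq, y', hy', hname⟩ := hG _ _ h1 h2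
  refine ⟨K q, ?_, h3 q y' hy' hname⟩
  rw [PFun.comp_apply, PFun.comp_apply]
  refine Part.mem_bind (Part.mem_bind (Part.mem_some _) hq) (Part.mem_some _)

/-! ### Cauchy names -/

namespace DenseSequence

variable {X : Type*} [MetricSpace X] (α : DenseSequence X)

theorem dist_le_of_isName {p : ℕ → ℕ} {x : X} (h : α.cauchyRep.IsName p x) (i : ℕ) :
    dist (α.pt (p i)) x ≤ (2 : ℝ)⁻¹ ^ i :=
  le_of_tendsto (tendsto_const_nhds.dist h.2)
    ((eventually_ge_atTop i).mono fun j hj => h.1 i j hj)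

/-- The extra factor `1/2` pays for the triangle inequality through the limit `x`. -/
theorem isName_of_dist_le {p : ℕ → ℕ} {x : X}
    (h : ∀ i, dist (α.pt (p i)) x ≤ (2 : ℝ)⁻¹ ^ (i + 1)) : α.cauchyRep.IsName p x := by
  refine ⟨fun i j hij => ?_, ?_⟩
  · have h1 := dist_triangle_right (α.pt (p i)) (α.pt (p j)) x
    have h2 : (2 : ℝ)⁻¹ ^ (j + 1) ≤ (2 : ℝ)⁻¹ ^ (i + 1) :=
      pow_le_pow_of_le_one (by norm_num) (by norm_num) (by omega)
    have h3 : (2 : ℝ)⁻¹ ^ (i + 1) + (2 : ℝ)⁻¹ ^ (i + 1) = (2 : ℝ)⁻¹ ^ i := by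
      rw [pow_succ]; ring
    linarith [h i, h j]
  · rw [tendsto_iff_dist_tendsto_zero]
    exact squeeze_zero (fun _ => dist_nonneg) h
      ((tendsto_pow_atTop_nhds_zero_of_lt_one (by norm_num) (by norm_num)).comp
        (tendsto_add_atTop_nat 1))

end DenseSequence

/-! ### Primitive recursive rational-valued functions -/

section PrimrecRat

variable {α β : Type*} [Primcodable α] [Primcodable β]

theorem PrimrecPred.imp {p q : α → Prop} (hp : PrimrecPred p) (hq : PrimrecPred q) :
    PrimrecPred fun x => p x → q x :=
  (hp.not.or hq).of_eq fun _ => (imp_iff_not_or).symm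

theorem PrimrecPred.exists_lt_comp {R : α → ℕ → Prop}
    (hR : PrimrecPred fun y : α × ℕ => R y.1 y.2) {N : α → ℕ}
    (hN : Primrec N) : PrimrecPred fun x => ∃ j < N x, R x j :=
  ((PrimrecRel.exists_mem_list (R := fun j x => R x j) hR.primrecRel.swap).comp
    (Primrec.list_range.comp hN) Primrec.id).of_eq fun x => by simp

theorem PrimrecPred.forall_lt_comp {R : α → ℕ → Prop}
    (hR : PrimrecPred fun y : α × ℕ => R y.1 y.2) {N : α → ℕ}
    (hN : Primrec N) : PrimrecPred fun x => ∀ j < N x, R x j :=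
  ((PrimrecRel.forall_mem_list (R := fun j x => R x j) hR.primrecRel.swap).comp
    (Primrec.list_range.comp hN) Primrec.id).of_eq fun x => by simp

theorem Primrec.nat_pow_comp {f g : α → ℕ} (hf : Primrec f) (hg : Primrec g) :
    Primrec fun x => f x ^ g x :=
  (Primrec₂.unpaired'.1 Nat.Primrec.pow).comp hf hg

theorem primrec_tupleEntry : Primrec₂ tupleEntry := by
  have h : Primrec₂ fun k i : ℕ => ((fun a : ℕ => a.unpair.2)^[i] k).unpair.1 :=
    (Primrec.fst.comp (Primrec.unpair.comp (Primrec.nat_iterate Primrec.snd Primrec.fst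
      (Primrec.snd.comp (Primrec.unpair.comp Primrec.snd)).to₂)) : _)
  refine h.of_eq fun k i => ?_
  induction i generalizing k with
  | zero => rfl
  | succ i ih => rw [Function.iterate_succ_apply, ih]; rfl

/-- The dimension is fixed, so `n` nested pairings suffice and no recursion on codes is needed. -/
theorem exists_primrec_tupleCode (n : ℕ) {f : α → ℕ → ℕ} (hf : Primrec₂ f) :
    ∃ c : α → ℕ, Primrec c ∧ ∀ x, ∀ i < n, tupleEntry (c x) i = f x i := by
  induction n generalizing f with
  | zero => exact ⟨fun _ => 0, Primrec.const 0, fun x i hi => absurd hi (Nat.not_lt_zero i)⟩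
  | succ n ih =>
    obtain ⟨c, hc, h⟩ := ih (f := fun x i => f x (i + 1))
      (hf.comp₂ Primrec₂.left (Primrec.succ.comp₂ Primrec₂.right))
    refine ⟨fun x => Nat.pair (f x 0) (c x),
      Primrec₂.natPair.comp (hf.comp Primrec.id (Primrec.const 0)) hc, fun x i hi => ?_⟩
    cases i with
    | zero => simp [tupleEntry]
    | succ i => simpa [tupleEntry] using h x i (by omega)

/-- `f` has a primitive recursive choice of codes with respect to `ratEnum`. -/
def PrimrecRat (f : α → ℚ) : Prop := ∃ m : α → ℕ, Primrec m ∧ ∀ x, ratEnum (m x) = f x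

namespace PrimrecRat

theorem of_fraction {f : α → ℚ} {a b c : α → ℕ} (ha : Primrec a) (hb : Primrec b)
    (hc : Primrec c) (h : ∀ x, f x = ((a x : ℚ) - b x) / ((c x : ℚ) + 1)) : PrimrecRat f :=
  ⟨fun x => Nat.pair (Nat.pair (a x) (b x)) (c x),
    Primrec₂.natPair.comp (Primrec₂.natPair.comp ha hb) hc, fun x => by simp [ratEnum, h x]⟩

/-- A shared form `(a - b) / (c + 1)` with natural `a`, `b`, `c` turns rational arithmetic and
comparison into arithmetic on `ℕ`. Codes need not be reduced or unique. -/
theorem fraction {f : α → ℚ} (hf : PrimrecRat f) : ∃ a b c : α → ℕ, Primrec a ∧ Primrec b ∧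
    Primrec c ∧ ∀ x, f x = ((a x : ℚ) - b x) / ((c x : ℚ) + 1) := by
  obtain ⟨m, hm, h⟩ := hf
  have h1 := Primrec.unpair.comp (Primrec.fst.comp (Primrec.unpair.comp hm))
  exact ⟨_, _, _, Primrec.fst.comp h1, Primrec.snd.comp h1,
    Primrec.snd.comp (Primrec.unpair.comp hm), fun x => (h x).symm⟩

theorem of_eq {f g : α → ℚ} (hf : PrimrecRat f) (h : ∀ x, f x = g x) : PrimrecRat g :=
  (funext h : f = g) ▸ hf

theorem comp {f : β → ℚ} (hf : PrimrecRat f) {g : α → β} (hg : Primrec g) :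
    PrimrecRat fun x => f (g x) :=
  let ⟨m, hm, h⟩ := hf
  ⟨fun x => m (g x), hm.comp hg, fun _ => h _⟩

theorem ratEnum : PrimrecRat ratEnum := ⟨id, Primrec.id, fun _ => rfl⟩

theorem natCast {f : α → ℕ} (hf : Primrec f) : PrimrecRat fun x => (f x : ℚ) :=
  of_fraction hf (Primrec.const 0) (Primrec.const 0) fun x => by simp

theorem const (q : ℚ) : PrimrecRat fun _ : α => q :=
  let ⟨m, hm⟩ := ratEnum_surj q
  ⟨fun _ => m, Primrec.const m, fun _ => hm⟩

theorem natCast_div {f g : α → ℕ} (hf : Primrec f) (hg : Primrec g) :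
    PrimrecRat fun x => (f x : ℚ) / ((g x : ℚ) + 1) :=
  of_fraction hf (Primrec.const 0) hg fun x => by simp

theorem nnratEnum : PrimrecRat nnratEnum :=
  natCast_div (Primrec.fst.comp Primrec.unpair) (Primrec.snd.comp Primrec.unpair)

theorem inv_natCast_pow (b : ℕ) (hb : 0 < b) {f : α → ℕ} (hf : Primrec f) :
    PrimrecRat fun x => ((b : ℚ) ^ f x)⁻¹ :=
  (natCast_div (Primrec.const 1)
    (Primrec.pred.comp (Primrec.nat_pow_comp (Primrec.const b) hf))).of_eq fun x => by
    have h : ((Nat.pred (b ^ f x) : ℕ) : ℚ) + 1 = (b : ℚ) ^ f x := by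
      exact_mod_cast Nat.succ_pred_eq_of_pos (pow_pos hb (f x))
    rw [h, Nat.cast_one, one_div]

theorem neg {f : α → ℚ} (hf : PrimrecRat f) : PrimrecRat fun x => -f x := by
  obtain ⟨a, b, c, ha, hb, hc, h⟩ := hf.fraction
  exact of_fraction hb ha hc fun x => by rw [h]; ring

theorem add {f g : α → ℚ} (hf : PrimrecRat f) (hg : PrimrecRat g) :
    PrimrecRat fun x => f x + g x := by
  obtain ⟨a, b, c, ha, hb, hc, h⟩ := hf.fraction
  obtain ⟨a', b', c', ha', hb', hc', h'⟩ := hg.fraction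
  have hs := Primrec.succ.comp hc
  have hs' := Primrec.succ.comp hc'
  refine of_fraction
    (a := fun x => a x * (c' x).succ + a' x * (c x).succ)
    (b := fun x => b x * (c' x).succ + b' x * (c x).succ)
    (c := fun x => c x * c' x + c x + c' x)
    (Primrec.nat_add.comp (Primrec.nat_mul.comp ha hs') (Primrec.nat_mul.comp ha' hs))
    (Primrec.nat_add.comp (Primrec.nat_mul.comp hb hs') (Primrec.nat_mul.comp hb' hs))
    (Primrec.nat_add.comp (Primrec.nat_add.comp (Primrec.nat_mul.comp hc hc') hc) hc')
    fun x => ?_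
  have h1 : (c x : ℚ) + 1 ≠ 0 := by positivity
  have h2 : (c' x : ℚ) + 1 ≠ 0 := by positivity
  have h3 : (c x : ℚ) * c' x + c x + c' x + 1 = (c x + 1) * (c' x + 1) := by ring
  rw [h, h']
  push_cast
  rw [h3]
  field_simp
  ring

theorem mul {f g : α → ℚ} (hf : PrimrecRat f) (hg : PrimrecRat g) :
    PrimrecRat fun x => f x * g x := by
  obtain ⟨a, b, c, ha, hb, hc, h⟩ := hf.fraction
  obtain ⟨a', b', c', ha', hb', hc', h'⟩ := hg.fraction
  refine of_fraction
    (a := fun x => a x * a' x + b x * b' x)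
    (b := fun x => a x * b' x + b x * a' x)
    (c := fun x => c x * c' x + c x + c' x)
    (Primrec.nat_add.comp (Primrec.nat_mul.comp ha ha') (Primrec.nat_mul.comp hb hb'))
    (Primrec.nat_add.comp (Primrec.nat_mul.comp ha hb') (Primrec.nat_mul.comp hb ha'))
    (Primrec.nat_add.comp (Primrec.nat_add.comp (Primrec.nat_mul.comp hc hc') hc) hc')
    fun x => ?_
  have h1 : (c x : ℚ) + 1 ≠ 0 := by positivity
  have h2 : (c' x : ℚ) + 1 ≠ 0 := by positivity
  have h3 : (c x : ℚ) * c' x + c x + c' x + 1 = (c x + 1) * (c' x + 1) := by ring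
  rw [h, h']
  push_cast
  rw [h3]
  field_simp
  ring

theorem sub {f g : α → ℚ} (hf : PrimrecRat f) (hg : PrimrecRat g) :
    PrimrecRat fun x => f x - g x :=
  (hf.add hg.neg).of_eq fun _ => (sub_eq_add_neg _ _).symm

theorem sq {f : α → ℚ} (hf : PrimrecRat f) : PrimrecRat fun x => f x ^ 2 :=
  (hf.mul hf).of_eq fun _ => (pow_two _).symm

theorem nonneg {f : α → ℚ} (hf : PrimrecRat f) : PrimrecPred fun x => 0 ≤ f x := by
  obtain ⟨a, b, c, ha, hb, hc, h⟩ := hf.fraction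
  refine (Primrec.nat_le.comp hb ha).of_eq fun x => ?_
  have h1 : (0 : ℚ) < (c x : ℚ) + 1 := by positivity
  rw [h, le_div_iff₀ h1, zero_mul, sub_nonneg, Nat.cast_le]

theorem le {f g : α → ℚ} (hf : PrimrecRat f) (hg : PrimrecRat g) :
    PrimrecPred fun x => f x ≤ g x :=
  (hg.sub hf).nonneg.of_eq fun _ => sub_nonneg

theorem lt {f g : α → ℚ} (hf : PrimrecRat f) (hg : PrimrecRat g) :
    PrimrecPred fun x => f x < g x :=
  (hg.le hf).not.of_eq fun _ => not_le

theorem ite {c : α → Prop} [DecidablePred c] {f g : α → ℚ} (hc : PrimrecPred c)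
    (hf : PrimrecRat f) (hg : PrimrecRat g) : PrimrecRat fun x => if c x then f x else g x := by
  obtain ⟨m, hm, h⟩ := hf
  obtain ⟨m', hm', h'⟩ := hg
  refine ⟨fun x => if c x then m x else m' x, Primrec.ite hc hm hm', fun x => ?_⟩
  by_cases hx : c x <;> simp [hx, h, h']

theorem max {f g : α → ℚ} (hf : PrimrecRat f) (hg : PrimrecRat g) :
    PrimrecRat fun x => max (f x) (g x) :=
  (ite (hf.le hg) hg hf).of_eq fun _ => (max_def _ _).symm

theorem min {f g : α → ℚ} (hf : PrimrecRat f) (hg : PrimrecRat g) :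
    PrimrecRat fun x => min (f x) (g x) :=
  (ite (hf.le hg) hf hg).of_eq fun _ => (min_def _ _).symm

theorem abs {f : α → ℚ} (hf : PrimrecRat f) : PrimrecRat fun x => |f x| :=
  hf.max hf.neg

theorem fract {f : α → ℚ} (hf : PrimrecRat f) : PrimrecRat fun x => Int.fract (f x) := by
  obtain ⟨a, b, c, ha, hb, hc, h⟩ := hf.fraction
  -- `(a - b) / (c + 1) = (a + b c) / (c + 1) - b`, so the fractional part comes from the remainder
  -- of `a + b c` modulo `c + 1`.
  refine (natCast_div (Primrec.nat_mod.comp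
    (Primrec.nat_add.comp ha (Primrec.nat_mul.comp hb hc)) (Primrec.succ.comp hc)) hc).of_eq
    fun x => ?_
  have h1 : (c x : ℚ) + 1 ≠ 0 := by positivity
  have h2 : f x = ((a x + b x * c x : ℕ) : ℚ) / ((c x + 1 : ℕ) : ℚ) - (b x : ℕ) := by
    rw [h]; push_cast; field_simp; ring
  rw [h2, Int.fract_sub_natCast, Int.fract_div_natCast_eq_div_natCast_mod]
  push_cast
  rfl

theorem sum_range {f : α → ℕ → ℚ} (hf : PrimrecRat fun x : α × ℕ => f x.1 x.2) {N : α → ℕ}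
    (hN : Primrec N) : PrimrecRat fun x => ∑ j ∈ Finset.range (N x), f x j := by
  obtain ⟨m, hm, h⟩ := hf
  obtain ⟨s, hs, hadd⟩ : PrimrecRat fun x : ℕ × ℕ => _root_.ratEnum x.1 + _root_.ratEnum x.2 :=
    (ratEnum.comp Primrec.fst).add (ratEnum.comp Primrec.snd)
  have hrec : Primrec fun x : α =>
      Nat.rec (motive := fun _ => ℕ) 0 (fun j r => s (r, m (x, j))) (N x) := by
    refine Primrec.nat_rec' hN (Primrec.const 0)
      (h := fun x jr => s (jr.2, m (x, jr.1))) ?_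
    exact hs.comp ((Primrec.snd.comp Primrec.snd).pair
      (hm.comp (Primrec.fst.pair (Primrec.fst.comp Primrec.snd))))
  refine ⟨_, hrec, fun x => ?_⟩
  beta_reduce
  generalize N x = k
  induction k with
  | zero => simp [_root_.ratEnum]
  | succ k ih => rw [Finset.sum_range_succ, ← ih, hadd]; simp only [h]

end PrimrecRat

end PrimrecRat

/-- This makes the first symbol of a Cauchy name an explicit bound for the point it names, from
which the required precision can be computed. -/
theorem abs_ratEnum_le (k : ℕ) : |ratEnum k| ≤ k := by
  have h1 : (0 : ℚ) < (k.unpair.2 : ℚ) + 1 := by positivity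
  have ha : ((k.unpair.1.unpair.1 : ℕ) : ℚ) ≤ k := by
    exact_mod_cast (Nat.unpair_left_le _).trans (Nat.unpair_left_le _)
  have hb : ((k.unpair.1.unpair.2 : ℕ) : ℚ) ≤ k := by
    exact_mod_cast (Nat.unpair_right_le _).trans (Nat.unpair_left_le _)
  have ha' : (0 : ℚ) ≤ (k.unpair.1.unpair.1 : ℕ) := by positivity
  have hb' : (0 : ℚ) ≤ (k.unpair.1.unpair.2 : ℕ) := by positivity
  have h2 : (0 : ℚ) ≤ k * k.unpair.2 := by positivity
  rw [ratEnum, abs_div, abs_of_pos h1, div_le_iff₀ h1, abs_le]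
  constructor <;> linarith

/-! ### Points and balls of `ℝⁿ` in coordinates -/

theorem euclideanSeq_pt_apply (n k : ℕ) (i : Fin n) :
    (euclideanSeq n).pt k i = (ratEnum (tupleEntry k i) : ℝ) := rfl

theorem ratEnum_zero : ratEnum 0 = 0 := by simp [ratEnum]

theorem nnratEnum_zero : nnratEnum 0 = 0 := by simp [nnratEnum]

theorem tupleEntry_zero (i : ℕ) : tupleEntry 0 i = 0 := by
  induction i with
  | zero => simp [tupleEntry]
  | succ i ih => simpa [tupleEntry] using ih

theorem euclideanSeq_pt_zero (n : ℕ) : (euclideanSeq n).pt 0 = 0 := by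
  ext i
  rw [euclideanSeq_pt_apply, tupleEntry_zero, ratEnum_zero]
  simp

theorem euclideanSeq_basicBall_zero (n : ℕ) : (euclideanSeq n).basicBall 0 = ∅ := by
  simp [DenseSequence.basicBall, nnratEnum_zero]

theorem EuclideanSpace.abs_apply_le_norm {n : ℕ} (z : EuclideanSpace ℝ (Fin n)) (i : Fin n) :
    |z i| ≤ ‖z‖ := by
  simpa using PiLp.norm_apply_le z i

theorem EuclideanSpace.norm_le_sum_abs {n : ℕ} (z : EuclideanSpace ℝ (Fin n)) :
    ‖z‖ ≤ ∑ i, |z i| := by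
  rw [EuclideanSpace.norm_eq]
  refine Real.sqrt_le_iff.mpr ⟨Finset.sum_nonneg fun i _ => abs_nonneg _, ?_⟩
  simpa using Finset.sum_sq_le_sq_sum_of_nonneg (s := Finset.univ) (f := fun i => |z i|)
    fun i _ => abs_nonneg _

/-- Squared norm of the `k`-th rational point. -/
def normSqEnum (n k : ℕ) : ℚ := ∑ i ∈ Finset.range n, ratEnum (tupleEntry k i) ^ 2

theorem primrecRat_normSqEnum (n : ℕ) : PrimrecRat (normSqEnum n) :=
  PrimrecRat.sum_range (f := fun k i => ratEnum (tupleEntry k i) ^ 2)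
    (PrimrecRat.ratEnum.comp primrec_tupleEntry).sq (Primrec.const n)

theorem normSqEnum_eq (n k : ℕ) : (normSqEnum n k : ℝ) = ‖(euclideanSeq n).pt k‖ ^ 2 := by
  rw [EuclideanSpace.norm_sq_eq, normSqEnum, Finset.sum_range]
  push_cast
  simp only [euclideanSeq_pt_apply, Real.norm_eq_abs, sq_abs]

/-! ### From accumulation points to projections -/

section Accumulation

/-- Centre of the `j`-th test interval. -/
def testCenter (j : ℕ) : ℚ := ratEnum j.unpair.1.unpair.1

/-- Radius of the `j`-th test interval. -/
def testRadius (j : ℕ) : ℚ := ((1 : ℕ) : ℚ) / ((j.unpair.1.unpair.2 : ℚ) + 1)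

/-- After `m` input symbols it is known that some term of the sequence, with index at least
`j.unpair.2`, lies in the `j`-th test interval. -/
def Visited (p : ℕ → ℕ) (m j : ℕ) : Prop :=
  ∃ e < m, j.unpair.2 ≤ e.unpair.1 ∧
    |ratEnum (p e) - testCenter j| + (((2 : ℕ) : ℚ) ^ e.unpair.2)⁻¹ < testRadius j

/-- The tent function of the `j`-th test interval. -/
def tent {k : Type*} [Field k] [LinearOrder k] (j : ℕ) (c : k) : k :=
  max 0 ((testRadius j : k) - |c - (testCenter j : k)|)

open Classical in
/-- The penalty at `c`, as known after `m` input symbols: tents over the test intervals, each one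
replaced by the constant `1` as soon as its interval has been visited. -/
noncomputable def stagePenalty {k : Type*} [Field k] [LinearOrder k] (p : ℕ → ℕ) (m : ℕ) (c : k) :
    k :=
  ∑ j ∈ Finset.range m, (((2 : ℕ) : k) ^ (j + 1))⁻¹ * (if Visited p m j then 1 else tent j c)

/-- Certificate that the ball with code `b` is contained in the set to be removed. -/
def Removable (n : ℕ) (p : ℕ → ℕ) (m b : ℕ) : Prop :=
  nnratEnum b.unpair.2 ≤ 1 ∧ ∃ e < m,
    normSqEnum n b.unpair.1 + (normSqEnum n b.unpair.1 + 3) * nnratEnum b.unpair.2 ≤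
      ratEnum (p e) ^ 2 + stagePenalty p m (ratEnum (tupleEntry b.unpair.1 0))

open Classical in
/-- Turns a name of a real sequence into a name of the origin paired with a closed set. -/
noncomputable def accumulationToProj (n : ℕ) (p : ℕ → ℕ) (m : ℕ) : ℕ :=
  if m % 2 = 1 ∧ Removable n p (m / 2) (m / 2).unpair.1 then (m / 2).unpair.1 else 0

variable {p p' : ℕ → ℕ} {m : ℕ}

theorem visited_congr (h : ∀ e < m, p e = p' e) (j : ℕ) : Visited p m j ↔ Visited p' m j := by
  unfold Visited
  refine exists_congr fun e => and_congr_right fun he => ?_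
  rw [h e he]

/-- A certificate of stage `m` consults only the first `m` symbols; this makes the functional
continuous with an explicit modulus. -/
theorem removable_congr (n : ℕ) (h : ∀ e < m, p e = p' e) (b : ℕ) :
    Removable n p m b ↔ Removable n p' m b := by
  have hv : Visited p m = Visited p' m := funext fun j => propext (visited_congr h j)
  unfold Removable stagePenalty
  rw [hv]
  refine and_congr_right fun _ => exists_congr fun e => and_congr_right fun he => ?_
  rw [h e he]

/-! ### Deciding the certificates -/

theorem primrecRat_testCenter : PrimrecRat testCenter :=
  PrimrecRat.ratEnum.comp (Primrec.fst.comp (Primrec.unpair.comp (Primrec.fst.comp Primrec.unpair)))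

theorem primrecRat_testRadius : PrimrecRat testRadius :=
  PrimrecRat.natCast_div (Primrec.const 1)
    (Primrec.snd.comp (Primrec.unpair.comp (Primrec.fst.comp Primrec.unpair)))

theorem primrecPred_visited :
    PrimrecPred fun x : (List ℕ × ℕ) × ℕ => Visited (fun e => x.1.1.getD e 0) x.1.2 x.2 := by
  refine PrimrecPred.exists_lt_comp ?_ (Primrec.snd.comp Primrec.fst)
  have hj : Primrec fun y : ((List ℕ × ℕ) × ℕ) × ℕ => y.1.2 := Primrec.snd.comp Primrec.fst
  have he : Primrec fun y : ((List ℕ × ℕ) × ℕ) × ℕ => y.2.unpair := Primrec.unpair.comp Primrec.snd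
  have hp : Primrec fun y : ((List ℕ × ℕ) × ℕ) × ℕ => y.1.1.1.getD y.2 0 :=
    (Primrec.list_getD 0).comp (Primrec.fst.comp (Primrec.fst.comp Primrec.fst)) Primrec.snd
  exact (Primrec.nat_le.comp (Primrec.snd.comp (Primrec.unpair.comp hj)) (Primrec.fst.comp he)).and
    ((((PrimrecRat.ratEnum.comp hp).sub (primrecRat_testCenter.comp hj)).abs.add
      (PrimrecRat.inv_natCast_pow 2 two_pos (Primrec.snd.comp he))).lt
        (primrecRat_testRadius.comp hj))

theorem primrecRat_stagePenalty : PrimrecRat fun x : (List ℕ × ℕ) × ℕ =>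
    stagePenalty (fun e => x.1.1.getD e 0) x.1.2 (ratEnum x.2) := by
  classical
  refine PrimrecRat.sum_range ?_ (Primrec.snd.comp Primrec.fst)
  have hj : Primrec fun y : ((List ℕ × ℕ) × ℕ) × ℕ => y.2 := Primrec.snd
  have hc : Primrec fun y : ((List ℕ × ℕ) × ℕ) × ℕ => y.1.2 := Primrec.snd.comp Primrec.fst
  refine (PrimrecRat.inv_natCast_pow 2 two_pos (Primrec.succ.comp hj)).mul
    (PrimrecRat.ite ?_ (PrimrecRat.const 1) ?_)
  · exact primrecPred_visited.comp ((Primrec.fst.comp Primrec.fst).pair hj)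
  · exact ((PrimrecRat.const 0).max ((primrecRat_testRadius.comp hj).sub
      ((PrimrecRat.ratEnum.comp hc).sub (primrecRat_testCenter.comp hj)).abs)).of_eq
        fun x => by simp [tent]

theorem primrecPred_removable (n : ℕ) :
    PrimrecPred fun x : (List ℕ × ℕ) × ℕ => Removable n (fun e => x.1.1.getD e 0) x.1.2 x.2 := by
  have hb : Primrec fun x : (List ℕ × ℕ) × ℕ => x.2.unpair := Primrec.unpair.comp Primrec.snd
  have hr : PrimrecRat fun x : (List ℕ × ℕ) × ℕ => nnratEnum x.2.unpair.2 :=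
    PrimrecRat.nnratEnum.comp (Primrec.snd.comp hb)
  have hN : PrimrecRat fun x : (List ℕ × ℕ) × ℕ => normSqEnum n x.2.unpair.1 :=
    (primrecRat_normSqEnum n).comp (Primrec.fst.comp hb)
  have hp : PrimrecRat fun y : ((List ℕ × ℕ) × ℕ) × ℕ => ratEnum (y.1.1.1.getD y.2 0) :=
    PrimrecRat.ratEnum.comp
      ((Primrec.list_getD 0).comp (Primrec.fst.comp (Primrec.fst.comp Primrec.fst)) Primrec.snd)
  have ht : Primrec fun x : (List ℕ × ℕ) × ℕ => tupleEntry x.2.unpair.1 0 :=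
    primrec_tupleEntry.comp (Primrec.fst.comp hb) (Primrec.const 0)
  have hs : PrimrecRat fun x : (List ℕ × ℕ) × ℕ =>
      stagePenalty (fun e => x.1.1.getD e 0) x.1.2 (ratEnum (tupleEntry x.2.unpair.1 0)) :=
    primrecRat_stagePenalty.comp (g := fun x : (List ℕ × ℕ) × ℕ =>
      (x.1, tupleEntry x.2.unpair.1 0)) (Primrec.fst.pair ht)
  have hl : PrimrecRat fun x : (List ℕ × ℕ) × ℕ => normSqEnum n x.2.unpair.1 +
      (normSqEnum n x.2.unpair.1 + 3) * nnratEnum x.2.unpair.2 :=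
    hN.add ((hN.add (PrimrecRat.const 3)).mul hr)
  unfold Removable
  refine (hr.le (PrimrecRat.const 1)).and
    (PrimrecPred.exists_lt_comp ?_ (Primrec.snd.comp Primrec.fst))
  exact (hl.comp Primrec.fst).le (hp.sq.add (hs.comp Primrec.fst))

theorem baireComputable_accumulationToProj (n : ℕ) :
    BaireComputable (PFun.lift (accumulationToProj n)) := by
  classical
  have hm : Primrec fun x : ℕ × List ℕ => x.1 / 2 :=
    Primrec.nat_div.comp Primrec.fst (Primrec.const 2)
  have hb : Primrec fun x : ℕ × List ℕ => (x.1 / 2).unpair.1 :=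
    Primrec.fst.comp (Primrec.unpair.comp hm)
  have hr : PrimrecPred fun x : ℕ × List ℕ =>
      Removable n (fun e => x.2.getD e 0) (x.1 / 2) (x.1 / 2).unpair.1 :=
    (primrecPred_removable n).comp (f := fun x : ℕ × List ℕ =>
      ((x.2, x.1 / 2), (x.1 / 2).unpair.1)) ((Primrec.snd.pair hm).pair hb)
  have ho : PrimrecPred fun x : ℕ × List ℕ => x.1 % 2 = 1 :=
    Primrec.eq.comp (Primrec.nat_mod.comp Primrec.fst (Primrec.const 2)) (Primrec.const 1)
  have hg : Primrec₂ fun (m : ℕ) (l : List ℕ) =>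
      accumulationToProj n (fun e => l.getD e 0) m := by
    unfold accumulationToProj
    exact Primrec.ite (ho.and hr) hb (Primrec.const 0)
  have key : accumulationToProj n = fun p m =>
      accumulationToProj n (fun e => (initialWord p m).getD e 0) m := by
    funext p m
    unfold accumulationToProj
    rw [removable_congr n (p := p) (p' := fun e => (initialWord p m).getD e 0)]
    intro e he
    rw [initialWord_getD]
    omega
  rw [key]
  exact baireComputable_lift_of_initialWord (len := fun m _ => m) Primrec₂.left hg

/-! ### Tents and penalties over the reals -/

theorem testRadius_le_one (j : ℕ) : testRadius j ≤ 1 := by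
  unfold testRadius
  rw [div_le_one (by positivity)]
  simp

theorem tent_nonneg (j : ℕ) (c : ℝ) : 0 ≤ tent j c := le_max_left _ _

theorem tent_le_one (j : ℕ) (c : ℝ) : tent j c ≤ 1 := by
  have h : (testRadius j : ℝ) ≤ 1 := by exact_mod_cast testRadius_le_one j
  exact max_le zero_le_one (by linarith [abs_nonneg (c - testCenter j)])

theorem tent_pos_iff (j : ℕ) (c : ℝ) : 0 < tent j c ↔ |c - testCenter j| < testRadius j := by
  simp [tent]

theorem tent_le_add (j : ℕ) (c c' : ℝ) : tent j c ≤ tent j c' + |c - c'| := by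
  refine max_le (add_nonneg (tent_nonneg _ _) (abs_nonneg _)) ?_
  have h1 := abs_sub_le c' c (testCenter j : ℝ)
  have h2 : (testRadius j : ℝ) - |c' - testCenter j| ≤ tent j c' := le_max_right _ _
  rw [abs_sub_comm c' c] at h1
  linarith

/-- Links the rational penalty, on which certificates are decided, to the real one used in the
analysis. -/
theorem ratCast_stagePenalty (p : ℕ → ℕ) (m : ℕ) (c : ℚ) :
    ((stagePenalty p m c : ℚ) : ℝ) = stagePenalty p m (c : ℝ) := by
  unfold stagePenalty tent
  push_cast
  refine Finset.sum_congr rfl fun j _ => ?_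
  split_ifs <;> push_cast <;> simp

theorem sum_inv_two_pow_le (m : ℕ) :
    ∑ j ∈ Finset.range m, (((2 : ℕ) : ℝ) ^ (j + 1))⁻¹ ≤ 1 := by
  have h : ∑ j ∈ Finset.range m, (((2 : ℕ) : ℝ) ^ (j + 1))⁻¹ = 1 - ((2 : ℝ) ^ m)⁻¹ := by
    induction m with
    | zero => simp
    | succ m ih =>
      rw [Finset.sum_range_succ, ih]
      push_cast
      field_simp
      ring
  rw [h]
  have : (0 : ℝ) < ((2 : ℝ) ^ m)⁻¹ := by positivity
  linarith

/-- Each summand is 1-Lipschitz before weighting and the weights sum to at most 1. The constant is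
independent of the stage, so one rational test at a centre controls a whole ball. -/
theorem stagePenalty_le_add (p : ℕ → ℕ) (m : ℕ) (c c' : ℝ) :
    stagePenalty p m c ≤ stagePenalty p m c' + |c - c'| := by
  classical
  have h : stagePenalty p m c ≤ stagePenalty p m c' +
      ∑ j ∈ Finset.range m, (((2 : ℕ) : ℝ) ^ (j + 1))⁻¹ * |c - c'| := by
    unfold stagePenalty
    rw [← Finset.sum_add_distrib]
    refine Finset.sum_le_sum fun j _ => ?_
    rw [← mul_add]
    refine mul_le_mul_of_nonneg_left ?_ (by positivity)
    split_ifs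
    · linarith [abs_nonneg (c - c')]
    · exact tent_le_add j c c'
  rw [← Finset.sum_mul] at h
  have h2 := mul_le_mul_of_nonneg_right (sum_inv_two_pow_le m) (abs_nonneg (c - c'))
  linarith

open Classical in
/-- The limit of the `j`-th summand of the penalty, without its weight. -/
noncomputable def limitTerm (p : ℕ → ℕ) (c : ℝ) (j : ℕ) : ℝ :=
  if ∃ m, Visited p m j then 1 else tent j c

/-- The limit of the stage penalties. -/
noncomputable def limitPenalty (p : ℕ → ℕ) (c : ℝ) : ℝ :=
  ∑' j, (((2 : ℕ) : ℝ) ^ (j + 1))⁻¹ * limitTerm p c j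

theorem limitTerm_nonneg (p : ℕ → ℕ) (c : ℝ) (j : ℕ) : 0 ≤ limitTerm p c j := by
  unfold limitTerm
  split_ifs
  · exact zero_le_one
  · exact tent_nonneg j c

theorem limitTerm_le_one (p : ℕ → ℕ) (c : ℝ) (j : ℕ) : limitTerm p c j ≤ 1 := by
  unfold limitTerm
  split_ifs
  · exact le_rfl
  · exact tent_le_one j c

theorem summable_limitTerm (p : ℕ → ℕ) (c : ℝ) :
    Summable fun j => (((2 : ℕ) : ℝ) ^ (j + 1))⁻¹ * limitTerm p c j := by
  refine summable_of_sum_range_le (c := 1)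
    (fun j => mul_nonneg (by positivity) (limitTerm_nonneg p c j)) fun m => ?_
  refine le_trans (Finset.sum_le_sum fun j _ => ?_) (sum_inv_two_pow_le m)
  exact mul_le_of_le_one_right (by positivity) (limitTerm_le_one p c j)

theorem limitPenalty_nonneg (p : ℕ → ℕ) (c : ℝ) : 0 ≤ limitPenalty p c :=
  tsum_nonneg fun j => mul_nonneg (by positivity) (limitTerm_nonneg p c j)

theorem Visited.mono {p : ℕ → ℕ} {m m' j : ℕ} (h : Visited p m j) (hm : m ≤ m') :
    Visited p m' j :=
  let ⟨e, he, h'⟩ := h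
  ⟨e, he.trans_le hm, h'⟩

/-- A visit can only raise a summand, since tents are at most 1; later summands are nonnegative. -/
theorem stagePenalty_le_limitPenalty (p : ℕ → ℕ) (m : ℕ) (c : ℝ) :
    stagePenalty p m c ≤ limitPenalty p c := by
  classical
  refine le_trans (Finset.sum_le_sum fun j _ => ?_) ((summable_limitTerm p c).sum_le_tsum
    (Finset.range m) fun j _ => mul_nonneg (by positivity) (limitTerm_nonneg p c j))
  refine mul_le_mul_of_nonneg_left ?_ (by positivity)
  unfold limitTerm
  by_cases h : Visited p m j
  · rw [if_pos h, if_pos ⟨m, h⟩]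
  · rw [if_neg h]
    split_ifs
    · exact tent_le_one j c
    · exact le_rfl

theorem tendsto_stagePenalty (p : ℕ → ℕ) (c : ℝ) :
    Tendsto (fun m => stagePenalty p m c) atTop (𝓝 (limitPenalty p c)) := by
  classical
  have hw : ∀ j : ℕ, (0 : ℝ) ≤ (((2 : ℕ) : ℝ) ^ (j + 1))⁻¹ := fun j => by positivity
  have hlim := (summable_limitTerm p c).hasSum.tendsto_sum_nat
  refine tendsto_order.mpr ⟨fun v hv => ?_, fun v hv => ?_⟩
  · obtain ⟨J, hJ⟩ := (hlim.eventually (lt_mem_nhds hv)).exists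
    have hev : ∀ᶠ m in atTop, ∀ j ∈ Finset.range J,
        limitTerm p c j ≤ (if Visited p m j then 1 else tent j c) := by
      rw [Filter.eventually_all_finset]
      intro j _
      by_cases h : ∃ m, Visited p m j
      · obtain ⟨m, hm⟩ := h
        filter_upwards [eventually_ge_atTop m] with m' hm'
        rw [if_pos (hm.mono hm')]
        exact limitTerm_le_one p c j
      · refine Eventually.of_forall fun m => ?_
        rw [if_neg fun h' => h ⟨m, h'⟩, limitTerm, if_neg h]
    filter_upwards [hev, eventually_ge_atTop J] with m hm hJm
    refine hJ.trans_le ?_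
    calc _ ≤ ∑ j ∈ Finset.range J, (((2 : ℕ) : ℝ) ^ (j + 1))⁻¹ *
          (if Visited p m j then 1 else tent j c) :=
          Finset.sum_le_sum fun j hj => mul_le_mul_of_nonneg_left (hm j hj) (hw j)
      _ ≤ stagePenalty p m c := by
          refine Finset.sum_le_sum_of_subset_of_nonneg (Finset.range_mono hJm) fun j _ _ => ?_
          refine mul_nonneg (hw j) ?_
          split_ifs
          · exact zero_le_one
          · exact tent_nonneg j c
  · exact Eventually.of_forall fun m =>
      (stagePenalty_le_limitPenalty p m c).trans_lt hv

/-! ### Visits and accumulation points -/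

theorem dist_ratEnum_le_of_isName {p : ℕ → ℕ} {s : ℕ → ℝ}
    (hp : realSeq.cauchyRep.seq.IsName p s) (e : ℕ) :
    |(ratEnum (p e) : ℝ) - s e.unpair.1| ≤ ((2 : ℝ) ^ e.unpair.2)⁻¹ := by
  have h := realSeq.dist_le_of_isName (hp e.unpair.1) e.unpair.2
  rw [Nat.pair_unpair, inv_pow] at h
  exact h

/-- A test interval is visited if and only if a late term of the sequence lies in it. -/
theorem exists_visited_iff {p : ℕ → ℕ} {s : ℕ → ℝ} (hp : realSeq.cauchyRep.seq.IsName p s)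
    (j : ℕ) : (∃ m, Visited p m j) ↔
      ∃ i ≥ j.unpair.2, |s i - testCenter j| < testRadius j := by
  constructor
  · rintro ⟨m, e, -, hi, he⟩
    refine ⟨_, hi, ?_⟩
    have h1 := dist_ratEnum_le_of_isName hp e
    have h2 : |(ratEnum (p e) : ℝ) - testCenter j| + ((2 : ℝ) ^ e.unpair.2)⁻¹ < testRadius j := by
      have h := (Rat.cast_lt (K := ℝ)).mpr he
      push_cast at h
      exact h
    have h3 := abs_sub_le (s e.unpair.1) (ratEnum (p e) : ℝ) (testCenter j : ℝ)
    rw [abs_sub_comm (s _) (ratEnum _ : ℝ)] at h3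
    linarith
  · rintro ⟨i, hi, hs⟩
    -- Half of the slack covers the error of the approximation, the other half the term `2⁻ˡ` that
    -- `Visited` demands.
    obtain ⟨l, hl⟩ := exists_pow_lt_of_lt_one
      (show (0 : ℝ) < (testRadius j - |s i - testCenter j|) / 2 by linarith)
      (show (2 : ℝ)⁻¹ < 1 by norm_num)
    rw [inv_pow] at hl
    refine ⟨Nat.pair i l + 1, Nat.pair i l, Nat.lt_succ_self _, ?_, ?_⟩
    · simpa using hi
    · have h1 := dist_ratEnum_le_of_isName hp (Nat.pair i l)
      simp only [Nat.unpair_pair] at h1 ⊢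
      have h3 := abs_sub_le (ratEnum (p (Nat.pair i l)) : ℝ) (s i) (testCenter j : ℝ)
      have h4 : |(ratEnum (p (Nat.pair i l)) : ℝ) - testCenter j| + ((2 : ℝ) ^ l)⁻¹ <
        testRadius j := by linarith
      rw [← Rat.cast_lt (K := ℝ)]
      push_cast
      exact h4

theorem tent_eq_zero_of_mapClusterPt {p : ℕ → ℕ} {s : ℕ → ℝ}
    (hp : realSeq.cauchyRep.seq.IsName p s) {c : ℝ} (hc : MapClusterPt c atTop s) {j : ℕ}
    (hj : ¬∃ m, Visited p m j) : tent j c = 0 := by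
  refine le_antisymm (not_lt.mp fun h => hj ?_) (tent_nonneg j c)
  rw [tent_pos_iff] at h
  have hopen : IsOpen {x : ℝ | |x - testCenter j| < testRadius j} :=
    isOpen_lt (by fun_prop) continuous_const
  have hfreq := mapClusterPt_iff_frequently.mp hc _ (hopen.mem_nhds h)
  obtain ⟨i, hi, hs⟩ := frequently_atTop.mp hfreq j.unpair.2
  exact (exists_visited_iff hp j).mpr ⟨i, hi, hs⟩

/-- Only accumulation points minimise the limit penalty. -/
theorem mapClusterPt_of_limitPenalty_le {p : ℕ → ℕ} {s : ℕ → ℝ}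
    (hp : realSeq.cauchyRep.seq.IsName p s) {c c' : ℝ} (hc' : MapClusterPt c' atTop s)
    (h : limitPenalty p c ≤ limitPenalty p c') : MapClusterPt c atTop s := by
  by_contra hc
  rw [mapClusterPt_iff_frequently] at hc
  push Not at hc
  obtain ⟨U, hU, hev⟩ := hc
  obtain ⟨ε, hε, hball⟩ := Metric.mem_nhds_iff.mp hU
  obtain ⟨τ, hτ⟩ := eventually_atTop.mp hev
  -- With radius below `ε / 2`, a test interval containing `c` lies within `ε` of `c`; paired with
  -- the time `τ` after which the sequence avoids `U`, it is never visited.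
  obtain ⟨k, hk⟩ := exists_nat_one_div_lt (half_pos hε)
  obtain ⟨q, hq⟩ := realSeq.dense.exists_dist_lt c (show (0 : ℝ) < 1 / (k + 1) by positivity)
  have hcen : testCenter (Nat.pair (Nat.pair q k) τ) = ratEnum q := by simp [testCenter]
  have hrad : (testRadius (Nat.pair (Nat.pair q k) τ) : ℝ) = 1 / (k + 1) := by simp [testRadius]
  have hq' : |c - ratEnum q| < 1 / (k + 1) := hq
  have hnv : ¬∃ m, Visited p m (Nat.pair (Nat.pair q k) τ) := by
    rw [exists_visited_iff hp]
    rintro ⟨i, hi, hs⟩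
    rw [hcen, hrad] at hs
    refine hτ i (by simpa using hi) (hball ?_)
    rw [Metric.mem_ball, Real.dist_eq]
    have h3 := abs_sub_le (s i) (ratEnum q : ℝ) c
    rw [abs_sub_comm (ratEnum q : ℝ) c] at h3
    linarith
  have hle : ∀ j, limitTerm p c' j ≤ limitTerm p c j := by
    intro j
    by_cases hj : ∃ m, Visited p m j
    · simp [limitTerm, hj]
    · rw [limitTerm, if_neg hj, tent_eq_zero_of_mapClusterPt hp hc' hj]
      exact limitTerm_nonneg p c j
  have hlt : limitTerm p c' (Nat.pair (Nat.pair q k) τ) <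
      limitTerm p c (Nat.pair (Nat.pair q k) τ) := by
    rw [limitTerm, if_neg hnv, limitTerm, if_neg hnv, tent_eq_zero_of_mapClusterPt hp hc' hnv,
      tent_pos_iff, hcen, hrad]
    exact hq'
  refine absurd h (not_le.mpr ?_)
  exact Summable.tsum_lt_tsum (fun j => mul_le_mul_of_nonneg_left (hle j) (by positivity))
    (mul_lt_mul_of_pos_left hlt (by positivity)) (summable_limitTerm p c') (summable_limitTerm p c)

/-! ### The closed set enumerated by the certificates -/

theorem accumulationToProj_even (n : ℕ) (p : ℕ → ℕ) (m : ℕ) :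
    accumulationToProj n p (2 * m) = 0 := by
  have h1 : (2 * m) % 2 = 0 := by omega
  simp [accumulationToProj, h1]

open Classical in
theorem accumulationToProj_odd (n : ℕ) (p : ℕ → ℕ) (m : ℕ) :
    accumulationToProj n p (2 * m + 1) =
      if Removable n p m m.unpair.1 then m.unpair.1 else 0 := by
  have h1 : (2 * m + 1) % 2 = 1 := by omega
  have h2 : (2 * m + 1) / 2 = m := by omega
  rw [accumulationToProj, h2]
  simp [h1]

theorem removable_iff {n : ℕ} {p : ℕ → ℕ} {m b : ℕ} :
    Removable n p m b ↔ (nnratEnum b.unpair.2 : ℝ) ≤ 1 ∧ ∃ e < m,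
      ‖(euclideanSeq n).pt b.unpair.1‖ ^ 2 +
          (‖(euclideanSeq n).pt b.unpair.1‖ ^ 2 + 3) * (nnratEnum b.unpair.2 : ℝ) ≤
        (ratEnum (p e) : ℝ) ^ 2 +
          stagePenalty p m (ratEnum (tupleEntry b.unpair.1 0) : ℝ) := by
  rw [← normSqEnum_eq, ← ratCast_stagePenalty, Removable]
  refine and_congr (by exact_mod_cast Iff.rfl) (exists_congr fun e => and_congr_right fun _ => ?_)
  rw [← Rat.cast_le (K := ℝ)]
  push_cast
  rfl

/-- The set removed by the certified balls. -/
theorem iUnion_basicBall_accumulationToProj {n : ℕ} (hn : 0 < n) (p : ℕ → ℕ) :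
    (⋃ i, (euclideanSeq n).basicBall (accumulationToProj n p (2 * i + 1))) =
      {z | ∃ e, ‖z‖ ^ 2 < (ratEnum (p e) : ℝ) ^ 2 + limitPenalty p (z ⟨0, hn⟩)} := by
  have hcoord : ∀ (k : ℕ) (z : EuclideanSpace ℝ (Fin n)),
      |(ratEnum (tupleEntry k 0) : ℝ) - z ⟨0, hn⟩| ≤ ‖z - (euclideanSeq n).pt k‖ := fun k z => by
    rw [abs_sub_comm]
    exact EuclideanSpace.abs_apply_le_norm (z - (euclideanSeq n).pt k) ⟨0, hn⟩
  ext z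
  simp only [Set.mem_iUnion, Set.mem_ofPred_eq, accumulationToProj_odd]
  constructor
  · rintro ⟨m, hm⟩
    by_cases hr : Removable n p m m.unpair.1
    · rw [if_pos hr] at hm
      obtain ⟨hr1, e, he, hcert⟩ := removable_iff.mp hr
      refine ⟨e, ?_⟩
      set k := m.unpair.1.unpair.1
      set r := nnratEnum m.unpair.1.unpair.2
      have hz : ‖z - (euclideanSeq n).pt k‖ < r := by
        simpa [DenseSequence.basicBall, dist_eq_norm] using hm
      have hz0 := hcoord k z
      have hlip := stagePenalty_le_add p m (ratEnum (tupleEntry k 0) : ℝ) (z ⟨0, hn⟩)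
      have hlim := stagePenalty_le_limitPenalty p m (z ⟨0, hn⟩)
      have htri : ‖z‖ ≤ ‖(euclideanSeq n).pt k‖ + ‖z - (euclideanSeq n).pt k‖ := by
        simpa using norm_add_le ((euclideanSeq n).pt k) (z - (euclideanSeq n).pt k)
      have hd := norm_nonneg (z - (euclideanSeq n).pt k)
      have hc := norm_nonneg ((euclideanSeq n).pt k)
      have hsq : ‖z‖ ^ 2 ≤ (‖(euclideanSeq n).pt k‖ + ‖z - (euclideanSeq n).pt k‖) ^ 2 :=
        pow_le_pow_left₀ (norm_nonneg z) htri 2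
      generalize ‖z - (euclideanSeq n).pt k‖ = d at *
      generalize ‖(euclideanSeq n).pt k‖ = c at *
      -- This gives `2cd ≤ (c² + 1) d`. Together with `d² ≤ d` and the Lipschitz error `d` of the
      -- penalty, it accounts for the factor `c² + 3` in the certificate.
      have h1 : 0 ≤ (c - 1) ^ 2 * d := mul_nonneg (sq_nonneg _) hd
      have h2 : d * d ≤ d * 1 := mul_le_mul_of_nonneg_left (hz.le.trans hr1) hd
      have h3 : (c ^ 2 + 3) * d < (c ^ 2 + 3) * r := mul_lt_mul_of_pos_left hz (by positivity)
      linarith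
    · rw [if_neg hr, euclideanSeq_basicBall_zero] at hm
      exact hm.elim
  · rintro ⟨e, hlt⟩
    obtain ⟨v, hv1, hv2⟩ := exists_between (sub_lt_iff_lt_add'.mpr hlt)
    -- For a centre within `r ≤ 1` of `z`, the first bracket times `r` bounds the change of the
    -- squared norm; the second bounds the error term of the certificate plus the Lipschitz error.
    have hC : 0 < (2 * ‖z‖ + 1) + ((‖z‖ + 1) ^ 2 + 4) := by positivity
    set C := (2 * ‖z‖ + 1) + ((‖z‖ + 1) ^ 2 + 4) with hCdef
    have hδ : 0 < (ratEnum (p e) : ℝ) ^ 2 + v - ‖z‖ ^ 2 := by linarith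
    obtain ⟨r, hr0, hr⟩ := exists_rat_btwn
      (show (0 : ℝ) < min 1 (((ratEnum (p e) : ℝ) ^ 2 + v - ‖z‖ ^ 2) / C) from
        lt_min one_pos (div_pos hδ hC))
    have hr1 : (r : ℝ) < 1 := hr.trans_le (min_le_left _ _)
    have hrC : (r : ℝ) * C < (ratEnum (p e) : ℝ) ^ 2 + v - ‖z‖ ^ 2 :=
      (lt_div_iff₀ hC).mp (hr.trans_le (min_le_right _ _))
    obtain ⟨l, hl⟩ := nnratEnum_surj r (by exact_mod_cast hr0.le)
    obtain ⟨k, hk⟩ := (euclideanSeq n).dense.exists_dist_lt z hr0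
    rw [dist_eq_norm] at hk
    obtain ⟨M, hM⟩ := eventually_atTop.mp
      ((tendsto_stagePenalty p (z ⟨0, hn⟩)).eventually (lt_mem_nhds hv2))
    -- Pairing the ball with `t` postpones its test until the penalty is large enough and symbol `e`
    -- has been read.
    let t := max M (e + 1)
    have ht : t ≤ Nat.pair (Nat.pair k l) t := Nat.right_le_pair _ _
    have hmem : z ∈ (euclideanSeq n).basicBall (Nat.pair k l) := by
      simpa [DenseSequence.basicBall, hl, dist_eq_norm] using hk
    refine ⟨Nat.pair (Nat.pair k l) t, ?_⟩
    rw [if_pos, Nat.unpair_pair]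
    · exact hmem
    rw [removable_iff]
    simp only [Nat.unpair_pair, hl]
    refine ⟨hr1.le, e, lt_of_lt_of_le (Nat.lt_succ_self e) ((le_max_right M (e + 1)).trans ht), ?_⟩
    have h1 := hM _ ((le_max_left M (e + 1)).trans ht)
    have h2 := stagePenalty_le_add p (Nat.pair (Nat.pair k l) t) (z ⟨0, hn⟩)
      (ratEnum (tupleEntry k 0) : ℝ)
    have h3 := hcoord k z
    rw [abs_sub_comm] at h3
    have h4 : ‖(euclideanSeq n).pt k‖ ≤ ‖z‖ + r := by
      have := norm_le_norm_add_norm_sub' ((euclideanSeq n).pt k) z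
      rw [norm_sub_rev] at this
      linarith
    have h5 : ‖(euclideanSeq n).pt k‖ ^ 2 ≤ (‖z‖ + r) ^ 2 :=
      pow_le_pow_left₀ (norm_nonneg _) h4 2
    have h6 : ‖(euclideanSeq n).pt k‖ ^ 2 ≤ (‖z‖ + 1) ^ 2 :=
      pow_le_pow_left₀ (norm_nonneg _) (by linarith) 2
    have h7 : (‖(euclideanSeq n).pt k‖ ^ 2 + 4) * (r : ℝ) ≤ ((‖z‖ + 1) ^ 2 + 4) * r :=
      mul_le_mul_of_nonneg_right (by linarith) hr0.le
    have h8 : (r : ℝ) * r ≤ r * 1 := mul_le_mul_of_nonneg_left hr1.le hr0.le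
    rw [hCdef] at hrC
    linarith

/-! ### Bounds and the reduction of accumulation to projection -/

theorem bddAbove_sq_ratEnum {p : ℕ → ℕ} {s : ℕ → ℝ} (hp : realSeq.cauchyRep.seq.IsName p s)
    (hs : IsCompact (closure (Set.range s))) :
    BddAbove (Set.range fun e => (ratEnum (p e) : ℝ) ^ 2) := by
  obtain ⟨C, hC⟩ := (hs.isBounded.subset subset_closure).exists_norm_le
  refine ⟨(C + 1) ^ 2, ?_⟩
  rintro _ ⟨e, rfl⟩
  have h1 := dist_ratEnum_le_of_isName hp e
  have h2 : |s e.unpair.1| ≤ C := hC _ (Set.mem_range_self _)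
  have h3 : ((2 : ℝ) ^ e.unpair.2)⁻¹ ≤ 1 := inv_le_one_of_one_le₀ (one_le_pow₀ one_le_two)
  have h4 := abs_sub_abs_le_abs_sub (ratEnum (p e) : ℝ) (s e.unpair.1)
  beta_reduce
  rw [← sq_abs]
  exact pow_le_pow_left₀ (abs_nonneg _) (by linarith) 2

theorem sq_le_of_mapClusterPt {p : ℕ → ℕ} {s : ℕ → ℝ} (hp : realSeq.cauchyRep.seq.IsName p s)
    {V : ℝ} (hV : ∀ e, (ratEnum (p e) : ℝ) ^ 2 ≤ V) {c : ℝ} (hc : MapClusterPt c atTop s) :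
    c ^ 2 ≤ V := by
  have hsi : ∀ i, s i ^ 2 ≤ V := fun i =>
    le_of_tendsto ((hp i).2.pow 2) (Eventually.of_forall fun j => hV _)
  by_contra hlt
  have hopen : IsOpen {x : ℝ | V < x ^ 2} := isOpen_lt continuous_const (by fun_prop)
  obtain ⟨i, hi⟩ := (mapClusterPt_iff_frequently.mp hc _ (hopen.mem_nhds (not_le.mp hlt))).exists
  exact absurd (hsi i) (not_le.mpr hi)

/-- The first coordinate of a name of a point of `ℝⁿ`. -/
theorem isName_firstCoordinate {n : ℕ} (hn : 0 < n) {q : ℕ → ℕ} {z : EuclideanSpace ℝ (Fin n)}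
    (hq : (euclideanSeq n).cauchyRep.IsName q z) :
    realSeq.cauchyRep.IsName (fun i => tupleEntry (q i) 0) (z ⟨0, hn⟩) := by
  refine ⟨fun i j hij => le_trans ?_ (hq.1 i j hij), ?_⟩
  · rw [dist_eq_norm]
    exact EuclideanSpace.abs_apply_le_norm
      ((euclideanSeq n).pt (q i) - (euclideanSeq n).pt (q j)) ⟨0, hn⟩
  · have hcont : Continuous fun z : EuclideanSpace ℝ (Fin n) => z ⟨0, hn⟩ := by fun_prop
    exact (hcont.tendsto z).comp hq.2

theorem baireComputable_firstCoordinate :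
    BaireComputable (PFun.lift fun (q : ℕ → ℕ) i => tupleEntry (q i) 0) := by
  have hg : Primrec₂ fun (i : ℕ) (l : List ℕ) => tupleEntry (l.getD i 0) 0 :=
    primrec_tupleEntry.comp ((Primrec.list_getD 0).comp Primrec.snd Primrec.fst) (Primrec.const 0)
  have key : (fun (q : ℕ → ℕ) i => tupleEntry (q i) 0) = fun q i =>
      tupleEntry ((initialWord q (i + 1)).getD i 0) 0 := by
    funext q i
    rw [initialWord_getD q (Nat.lt_succ_self i)]
  rw [key]
  exact baireComputable_lift_of_initialWord (len := fun i _ => i + 1)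
    (Primrec.succ.comp₂ Primrec₂.left) hg

/-- The second coordinate absorbs `w - c²`; this is where dimension at least two enters. -/
theorem EuclideanSpace.exists_apply_eq_and_norm_sq_eq {n : ℕ} (hn : 2 ≤ n) (c w : ℝ)
    (h : c ^ 2 ≤ w) : ∃ z : EuclideanSpace ℝ (Fin n), z ⟨0, by omega⟩ = c ∧ ‖z‖ ^ 2 = w := by
  obtain ⟨n, rfl⟩ := Nat.exists_eq_add_of_le' hn
  refine ⟨WithLp.toLp 2 (Fin.cons c (Fin.cons (Real.sqrt (w - c ^ 2)) fun _ => 0)), rfl, ?_⟩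
  rw [EuclideanSpace.norm_sq_eq, Fin.sum_univ_succ, Fin.sum_univ_succ]
  simp [Real.sq_sqrt (sub_nonneg.mpr h)]

theorem bwt_reducible_projNeg {n : ℕ} (hn : 2 ≤ n) :
    StrongWeihrauchReducible (BWT realSeq) (projNeg (euclideanSeq n)) := by
  refine .of_lift (baireComputable_accumulationToProj n) baireComputable_firstCoordinate ?_
  rintro p s hp ⟨c, hcomp, hc⟩
  have hp : realSeq.cauchyRep.seq.IsName p s := hp
  have hn0 : 0 < n := by omega
  have hbdd := bddAbove_sq_ratEnum hp hcomp
  set V := ⨆ e, (ratEnum (p e) : ℝ) ^ 2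
  have hV : ∀ e, (ratEnum (p e) : ℝ) ^ 2 ≤ V := le_ciSup hbdd
  let A : Closeds (EuclideanSpace ℝ (Fin n)) :=
    ⟨(⋃ i, (euclideanSeq n).basicBall (accumulationToProj n p (2 * i + 1)))ᶜ,
      (isOpen_iUnion fun _ => Metric.isOpen_ball).isClosed_compl⟩
  have hA : ∀ z, z ∈ A ↔ V + limitPenalty p (z ⟨0, hn0⟩) ≤ ‖z‖ ^ 2 := by
    intro z
    change z ∈ (⋃ i, (euclideanSeq n).basicBall (accumulationToProj n p (2 * i + 1)))ᶜ ↔ _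
    rw [iUnion_basicBall_accumulationToProj hn0, Set.mem_compl_iff, Set.mem_ofPred_eq]
    push Not
    constructor
    · intro h
      have : V ≤ ‖z‖ ^ 2 - limitPenalty p (z ⟨0, hn0⟩) := ciSup_le fun e => by linarith [h e]
      linarith
    · intro h e
      linarith [hV e]
  -- A point on the boundary inequality of `A` over the accumulation point `c`; its norm bounds that
  -- of every projection of the origin.
  obtain ⟨z₀, hz₀, hnorm⟩ := EuclideanSpace.exists_apply_eq_and_norm_sq_eq hn c
    (V + limitPenalty p c)
    (by linarith [sq_le_of_mapClusterPt hp hV hc, limitPenalty_nonneg p c])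
  have hz₀A : z₀ ∈ A := by rw [hA, hz₀, hnorm]
  refine ⟨(0, A), ⟨?_, rfl⟩, ?_, ?_⟩
  · refine (euclideanSeq n).isName_of_dist_le fun i => ?_
    rw [accumulationToProj_even, euclideanSeq_pt_zero]
    simp
  · obtain ⟨y, hy, hdist⟩ := A.isClosed.exists_infDist_eq_dist ⟨z₀, hz₀A⟩ 0
    exact ⟨y, hy, hdist.symm⟩
  · intro q (y : EuclideanSpace ℝ (Fin n)) ⟨hy, hdist⟩ hq
    refine ⟨y ⟨0, hn0⟩, ⟨hcomp, mapClusterPt_of_limitPenalty_le hp hc ?_⟩,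
      isName_firstCoordinate hn0 hq⟩
    have h1 : ‖y‖ ≤ ‖z₀‖ := by
      have h := Metric.infDist_le_dist_of_mem (x := (0 : EuclideanSpace ℝ (Fin n))) hz₀A
      rw [dist_zero_left] at h
      rw [← dist_zero_left y]
      exact (le_of_eq hdist).trans h
    have h2 := pow_le_pow_left₀ (norm_nonneg y) h1 2
    have h3 := (hA y).mp hy
    linarith

end Accumulation

/-! ### A curve that fills `ℝⁿ` -/

section Curve

section Definitions

variable {k : Type*} [Field k] [LinearOrder k] [IsStrictOrderedRing k] [FloorRing k]

/-- Distance to the nearest integer. -/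
def triangleWave (x : k) : k := |x - round x|

/-- A continuous function of period `1` that is `0` on `[0, 1/4]` and `1` on `[1/2, 3/4]`. -/
def plateauWave (x : k) : k := max 0 (min 1 (3 / 2 - 4 * triangleWave (x - 5 / 8)))

/-- Partial sums of the `i`-th coordinate of Schoenberg's space-filling curve. -/
def curveSum (n J i : ℕ) (t : k) : k :=
  ∑ j ∈ Finset.range J, (((2 : ℕ) : k) ^ (j + 1))⁻¹ *
    plateauWave (((4 : ℕ) : k) ^ (n * j + i + 1) * t)

/-- Approximations to the `i`-th coordinate of a curve that, for `t` in `[N, N + 1]`, covers the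
cube with side length `2 N` around the origin. -/
def curveApprox (n J i : ℕ) (t : k) : k := (t - triangleWave t) * (2 * curveSum n J i t - 1)

end Definitions

/-! ### Rational evaluation of the approximating curves -/

theorem ratCast_triangleWave (q : ℚ) : ((triangleWave q : ℚ) : ℝ) = triangleWave (q : ℝ) := by
  simp [triangleWave, Rat.round_cast]

theorem ratCast_plateauWave (q : ℚ) : ((plateauWave q : ℚ) : ℝ) = plateauWave (q : ℝ) := by
  have h := ratCast_triangleWave (q - 5 / 8)
  push_cast at h
  simp [plateauWave, h]

theorem ratCast_curveApprox (n J i : ℕ) (q : ℚ) :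
    ((curveApprox n J i q : ℚ) : ℝ) = curveApprox n J i (q : ℝ) := by
  unfold curveApprox curveSum
  push_cast
  simp only [ratCast_triangleWave, ratCast_plateauWave]
  push_cast
  rfl

section Primrec

variable {α : Type*} [Primcodable α]

theorem PrimrecRat.triangleWave {f : α → ℚ} (hf : PrimrecRat f) :
    PrimrecRat fun x => triangleWave (f x) :=
  (hf.fract.min ((PrimrecRat.const 1).sub hf.fract)).of_eq
    fun _ => (abs_sub_round_eq_min _).symm

theorem PrimrecRat.plateauWave {f : α → ℚ} (hf : PrimrecRat f) :
    PrimrecRat fun x => plateauWave (f x) :=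
  (PrimrecRat.const 0).max ((PrimrecRat.const 1).min ((PrimrecRat.const (3 / 2)).sub
    ((PrimrecRat.const 4).mul (hf.sub (PrimrecRat.const (5 / 8))).triangleWave)))

theorem primrecRat_curveSum (n : ℕ) :
    PrimrecRat fun x : (ℕ × ℕ) × ℕ => curveSum n x.1.1 x.1.2 (ratEnum x.2) := by
  unfold curveSum
  refine PrimrecRat.sum_range ?_ (Primrec.fst.comp Primrec.fst)
  have hexp : Primrec fun y : ((ℕ × ℕ) × ℕ) × ℕ => n * y.2 + y.1.1.2 + 1 :=
    Primrec.succ.comp (Primrec.nat_add.comp (Primrec.nat_mul.comp (Primrec.const n) Primrec.snd)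
      (Primrec.snd.comp (Primrec.fst.comp Primrec.fst)))
  have hpow : PrimrecRat fun y : ((ℕ × ℕ) × ℕ) × ℕ => ((4 : ℕ) : ℚ) ^ (n * y.2 + y.1.1.2 + 1) :=
    (PrimrecRat.natCast (Primrec.nat_pow_comp (Primrec.const 4) hexp)).of_eq fun y => by
      push_cast; rfl
  exact (PrimrecRat.inv_natCast_pow 2 two_pos (Primrec.succ.comp Primrec.snd)).mul
    (hpow.mul (PrimrecRat.ratEnum.comp (Primrec.snd.comp Primrec.fst))).plateauWave

theorem PrimrecRat.curveApprox (n : ℕ) {J i : α → ℕ} {t : α → ℚ} (hJ : Primrec J)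
    (hi : Primrec i) (ht : PrimrecRat t) :
    PrimrecRat fun x => curveApprox n (J x) (i x) (t x) := by
  obtain ⟨c, hc, h⟩ := ht
  have hs : PrimrecRat fun x => curveSum n (J x) (i x) (_root_.ratEnum (c x)) :=
    (primrecRat_curveSum n).comp (g := fun x => ((J x, i x), c x)) ((hJ.pair hi).pair hc)
  have hr : PrimrecRat fun x => _root_.ratEnum (c x) := PrimrecRat.ratEnum.comp hc
  refine ((hr.sub hr.triangleWave).mul (((PrimrecRat.const 2).mul hs).sub
    (PrimrecRat.const 1))).of_eq fun x => ?_
  rw [h]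
  rfl

end Primrec

/-! ### Lipschitz bounds and convergence -/

theorem triangleWave_nonneg (x : ℝ) : 0 ≤ triangleWave x := abs_nonneg _

theorem triangleWave_le_half (x : ℝ) : triangleWave x ≤ 1 / 2 := abs_sub_round x

theorem triangleWave_le_add (x y : ℝ) : triangleWave x ≤ triangleWave y + |x - y| := by
  have h1 := round_le x (round y)
  have h2 := abs_sub_le x y (round y : ℝ)
  unfold triangleWave
  linarith

theorem abs_triangleWave_sub_le (x y : ℝ) : |triangleWave x - triangleWave y| ≤ |x - y| := by
  have h1 := triangleWave_le_add x y
  have h2 := triangleWave_le_add y x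
  rw [abs_sub_comm y x] at h2
  rw [abs_le]
  constructor <;> linarith

theorem plateauWave_nonneg (x : ℝ) : 0 ≤ plateauWave x := le_max_left _ _

theorem plateauWave_le_one (x : ℝ) : plateauWave x ≤ 1 := max_le zero_le_one (min_le_left _ _)

theorem abs_plateauWave_sub_le (x y : ℝ) : |plateauWave x - plateauWave y| ≤ 4 * |x - y| := by
  have h1 : |plateauWave x - plateauWave y| ≤
      |min 1 (3 / 2 - 4 * triangleWave (x - 5 / 8)) -
        min 1 (3 / 2 - 4 * triangleWave (y - 5 / 8))| := by
    unfold plateauWave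
    refine (abs_max_sub_max_le_max _ _ _ _).trans ?_
    simp
  refine h1.trans ((abs_min_sub_min_le_max _ _ _ _).trans ?_)
  have h2 := abs_triangleWave_sub_le (x - 5 / 8) (y - 5 / 8)
  have h3 : 3 / 2 - 4 * triangleWave (x - 5 / 8) - (3 / 2 - 4 * triangleWave (y - 5 / 8)) =
      -(4 * (triangleWave (x - 5 / 8) - triangleWave (y - 5 / 8))) := by ring
  rw [h3, abs_neg, abs_mul, abs_of_pos (by norm_num : (0 : ℝ) < 4)]
  rw [sub_sub_sub_cancel_right] at h2
  refine max_le ?_ (by linarith)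
  simp

/-- Here `z + w` is at distance at least `3/8` from every integer shifted by `5/8`, which makes `3/2
- 4 · (3/8) = 0` the largest possible height. -/
theorem plateauWave_eq_zero (z : ℤ) {w : ℝ} (h0 : 0 ≤ w) (h1 : w ≤ 1 / 4) :
    plateauWave (z + w) = 0 := by
  have h : 3 / 8 ≤ triangleWave (z + w - 5 / 8 : ℝ) := by
    unfold triangleWave
    generalize round (z + w - 5 / 8 : ℝ) = r
    rcases le_or_gt z r with hz | hz
    · have : (z : ℝ) ≤ r := by exact_mod_cast hz
      rw [abs_of_nonpos] <;> linarith
    · have : (r : ℝ) + 1 ≤ z := by exact_mod_cast hz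
      rw [abs_of_nonneg] <;> linarith
  exact max_eq_left (min_le_of_right_le (by linarith))

theorem plateauWave_eq_one (z : ℤ) {w : ℝ} (h0 : 1 / 2 ≤ w) (h1 : w ≤ 3 / 4) :
    plateauWave (z + w) = 1 := by
  have h : triangleWave (z + w - 5 / 8 : ℝ) ≤ 1 / 8 := by
    refine (round_le _ z).trans ?_
    rw [abs_le]
    constructor <;> linarith
  unfold plateauWave
  rw [min_eq_left (by linarith), max_eq_right zero_le_one]

theorem curveSum_nonneg (n J i : ℕ) (t : ℝ) : 0 ≤ curveSum n J i t :=
  Finset.sum_nonneg fun _ _ => mul_nonneg (by positivity) (plateauWave_nonneg _)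

theorem curveSum_le_one (n J i : ℕ) (t : ℝ) : curveSum n J i t ≤ 1 :=
  (Finset.sum_le_sum fun _ _ => mul_le_of_le_one_right (by positivity)
    (plateauWave_le_one _)).trans (sum_inv_two_pow_le J)

theorem abs_curveSum_sub_le {n J i : ℕ} (hi : i < n) (t s : ℝ) :
    |curveSum n J i t - curveSum n J i s| ≤ 4 * 4 ^ (n * J) * |t - s| := by
  unfold curveSum
  rw [← Finset.sum_sub_distrib]
  refine (Finset.abs_sum_le_sum_abs _ _).trans ?_
  calc _ ≤ ∑ j ∈ Finset.range J, (((2 : ℕ) : ℝ) ^ (j + 1))⁻¹ * (4 * 4 ^ (n * J) * |t - s|) := by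
        refine Finset.sum_le_sum fun j hj => ?_
        rw [← mul_sub, abs_mul,
          abs_of_nonneg (by positivity : (0 : ℝ) ≤ (((2 : ℕ) : ℝ) ^ (j + 1))⁻¹)]
        refine mul_le_mul_of_nonneg_left ((abs_plateauWave_sub_le _ _).trans ?_) (by positivity)
        rw [← mul_sub, abs_mul, abs_of_nonneg (by positivity), mul_assoc]
        refine mul_le_mul_of_nonneg_left (mul_le_mul_of_nonneg_right ?_ (abs_nonneg _))
          (by norm_num)
        push_cast
        refine pow_le_pow_right₀ (by norm_num) ?_
        have : n * (j + 1) ≤ n * J := Nat.mul_le_mul_left n (Finset.mem_range.mp hj)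
        rw [Nat.mul_succ] at this
        omega
    _ ≤ _ := by
        rw [← Finset.sum_mul]
        exact mul_le_of_le_one_left (by positivity) (sum_inv_two_pow_le J)

/-- The `i`-th coordinate of the limit of the curves `curveApprox n J`. -/
noncomputable def curveLimit (n i : ℕ) (t : ℝ) : ℝ :=
  (t - triangleWave t) * (2 * (∑' j, (((2 : ℕ) : ℝ) ^ (j + 1))⁻¹ *
    plateauWave (((4 : ℕ) : ℝ) ^ (n * j + i + 1) * t)) - 1)

theorem abs_curveSum_sub_tsum_le (n J i : ℕ) (t : ℝ) :
    |curveSum n J i t - ∑' j, (((2 : ℕ) : ℝ) ^ (j + 1))⁻¹ *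
      plateauWave (((4 : ℕ) : ℝ) ^ (n * j + i + 1) * t)| ≤ ((2 : ℝ) ^ J)⁻¹ := by
  have hsum : Summable fun j : ℕ => (((2 : ℕ) : ℝ) ^ (j + 1))⁻¹ *
      plateauWave (((4 : ℕ) : ℝ) ^ (n * j + i + 1) * t) :=
    summable_of_sum_range_le (c := 1)
      (fun j => mul_nonneg (by positivity) (plateauWave_nonneg _)) fun m =>
        curveSum_le_one n m i t
  have hstep : ∀ J' ≥ J, curveSum n J i t ≤ curveSum n J' i t ∧
      curveSum n J' i t ≤ curveSum n J i t + (((2 : ℝ) ^ J)⁻¹ - ((2 : ℝ) ^ J')⁻¹) := by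
    intro J' hJ'
    induction J', hJ' using Nat.le_induction with
    | base => simp
    | succ J' _ ih =>
      have h1 : curveSum n (J' + 1) i t = curveSum n J' i t + (((2 : ℕ) : ℝ) ^ (J' + 1))⁻¹ *
          plateauWave (((4 : ℕ) : ℝ) ^ (n * J' + i + 1) * t) := Finset.sum_range_succ _ _
      have hw : (0 : ℝ) ≤ ((2 : ℝ) ^ (J' + 1))⁻¹ := by positivity
      have h2 := mul_nonneg hw (plateauWave_nonneg (((4 : ℕ) : ℝ) ^ (n * J' + i + 1) * t))
      have h3 := mul_le_of_le_one_right hw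
        (plateauWave_le_one (((4 : ℕ) : ℝ) ^ (n * J' + i + 1) * t))
      have h4 : ((2 : ℝ) ^ J')⁻¹ = 2 * ((2 : ℝ) ^ (J' + 1))⁻¹ := by
        rw [pow_succ]; field_simp
      push_cast at h1 h2 h3
      constructor <;> linarith [ih.1, ih.2]
  have hlim : Tendsto (fun J' => curveSum n J' i t) atTop _ := hsum.hasSum.tendsto_sum_nat
  have hge := ge_of_tendsto hlim ((eventually_ge_atTop J).mono fun J' h => (hstep J' h).1)
  have hle := le_of_tendsto (b := curveSum n J i t + ((2 : ℝ) ^ J)⁻¹) hlim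
    ((eventually_ge_atTop J).mono fun J' h => by
      have : (0 : ℝ) < ((2 : ℝ) ^ J')⁻¹ := by positivity
      linarith [(hstep J' h).2])
  rw [abs_le]
  constructor
  · linarith
  · linarith [show (0 : ℝ) < ((2 : ℝ) ^ J)⁻¹ by positivity]

theorem abs_sub_triangleWave_le (t : ℝ) : |t - triangleWave t| ≤ |t| + 1 := by
  have h1 := abs_sub t (triangleWave t)
  rw [abs_of_nonneg (triangleWave_nonneg t)] at h1
  linarith [triangleWave_le_half t]

theorem abs_curveApprox_sub_curveLimit_le (n J i : ℕ) (t : ℝ) :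
    |curveApprox n J i t - curveLimit n i t| ≤ 2 * (|t| + 1) * ((2 : ℝ) ^ J)⁻¹ := by
  unfold curveApprox curveLimit
  rw [← mul_sub, abs_mul, sub_sub_sub_cancel_right, ← mul_sub, abs_mul, abs_two]
  have h1 := abs_curveSum_sub_tsum_le n J i t
  calc _ ≤ (|t| + 1) * (2 * ((2 : ℝ) ^ J)⁻¹) := by
        gcongr
        exact abs_sub_triangleWave_le t
    _ = _ := by ring

/-- Product rule: the amplitude is 2-Lipschitz against a factor bounded by 1, and is itself at most
`|t| + 1` against a factor with Lipschitz constant `8 · 4 ^ (n * J)`. -/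
theorem abs_curveApprox_sub_le {n J i : ℕ} (hi : i < n) (q t : ℝ) :
    |curveApprox n J i q - curveApprox n J i t| ≤
      (2 + 8 * (|t| + 1) * 4 ^ (n * J)) * |q - t| := by
  have h1 := abs_curveSum_sub_le (J := J) hi q t
  have h2 : |2 * curveSum n J i q - 1| ≤ 1 := by
    rw [abs_le]
    constructor <;> linarith [curveSum_nonneg n J i q, curveSum_le_one n J i q]
  have h3 : |(q - triangleWave q) - (t - triangleWave t)| ≤ 2 * |q - t| := by
    have h := abs_sub (q - t) (triangleWave q - triangleWave t)
    have h' := abs_triangleWave_sub_le q t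
    rw [show q - triangleWave q - (t - triangleWave t) =
      q - t - (triangleWave q - triangleWave t) by ring]
    linarith
  have h4 := abs_sub_triangleWave_le t
  have key : curveApprox n J i q - curveApprox n J i t =
      ((q - triangleWave q) - (t - triangleWave t)) * (2 * curveSum n J i q - 1) +
      (t - triangleWave t) * (2 * (curveSum n J i q - curveSum n J i t)) := by
    unfold curveApprox; ring
  rw [key]
  refine (abs_add_le _ _).trans ?_
  rw [abs_mul, abs_mul, abs_mul, abs_two]
  calc _ ≤ (2 * |q - t|) * 1 + (|t| + 1) * (2 * (4 * 4 ^ (n * J) * |q - t|)) := by gcongr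
    _ = _ := by ring

theorem continuous_curveApprox {n J i : ℕ} (hi : i < n) :
    Continuous (curveApprox n J i : ℝ → ℝ) := by
  refine continuous_iff_continuousAt.mpr fun t => ?_
  rw [ContinuousAt, tendsto_iff_dist_tendsto_zero]
  refine squeeze_zero (fun _ => dist_nonneg) (fun q => abs_curveApprox_sub_le hi q t) ?_
  have h : Tendsto (fun q : ℝ => (2 + 8 * (|t| + 1) * 4 ^ (n * J)) * |q - t|) (𝓝 t)
      (𝓝 ((2 + 8 * (|t| + 1) * 4 ^ (n * J)) * |t - t|)) :=
    Continuous.tendsto (by fun_prop) t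
  simpa using h

theorem tendsto_inv_two_pow : Tendsto (fun J : ℕ => ((2 : ℝ) ^ J)⁻¹) atTop (𝓝 0) := by
  simpa using tendsto_pow_atTop_nhds_zero_of_lt_one (r := (2 : ℝ)⁻¹) (by norm_num) (by norm_num)

/-- The amplitude grows with `t`, so the error bound is uniform only locally; a unit ball around `t`
is enough. -/
theorem continuous_curveLimit {n i : ℕ} (hi : i < n) : Continuous (curveLimit n i) := by
  refine continuous_iff_continuousAt.mpr fun t =>
    continuousAt_of_locally_uniform_approx_of_continuousAt fun U hU => ?_
  obtain ⟨ε, hε, hsub⟩ := Metric.mem_uniformity_dist.mp hU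
  have hlim : Tendsto (fun J : ℕ => 2 * (|t| + 2) * ((2 : ℝ) ^ J)⁻¹) atTop (𝓝 0) := by
    simpa using tendsto_inv_two_pow.const_mul (2 * (|t| + 2))
  obtain ⟨J, hJ⟩ := (hlim.eventually (gt_mem_nhds hε)).exists
  refine ⟨Metric.ball t 1, Metric.ball_mem_nhds t one_pos, curveApprox n J i,
    (continuous_curveApprox hi).continuousAt, fun y hy => hsub ?_⟩
  rw [dist_comm]
  refine lt_of_le_of_lt ((abs_curveApprox_sub_curveLimit_le n J i y).trans ?_) hJ
  have h1 : |y - t| < 1 := hy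
  have h2 := abs_sub_abs_le_abs_sub y t
  exact mul_le_mul_of_nonneg_right (by linarith) (by positivity)

/-- The approximating curves converge continuously. -/
theorem tendsto_curveApprox {n i : ℕ} (hi : i < n) {t : ℝ} {u : ℕ → ℝ} {J : ℕ → ℕ}
    (hu : Tendsto u atTop (𝓝 t)) (hJ : Tendsto J atTop atTop) :
    Tendsto (fun k => curveApprox n (J k) i (u k)) atTop (𝓝 (curveLimit n i t)) := by
  have h1 := ((continuous_curveLimit hi).tendsto t).comp hu
  have h2 : Tendsto (fun k => 2 * (|u k| + 1) * ((2 : ℝ) ^ J k)⁻¹) atTop (𝓝 0) := by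
    simpa using ((hu.abs.add_const 1).const_mul 2).mul (tendsto_inv_two_pow.comp hJ)
  have h3 : Tendsto (fun k => curveApprox n (J k) i (u k) - curveLimit n i (u k)) atTop (𝓝 0) :=
    squeeze_zero_norm (fun k => abs_curveApprox_sub_curveLimit_le n (J k) i (u k)) h2
  simpa using h3.add h1

/-! ### Density of the grid points of the curve -/

theorem exists_binary_digits (k : ℕ) {β : ℝ} (h0 : 0 ≤ β) (h1 : β ≤ 1) :
    ∃ d : ℕ → ℕ, (∀ j, d j ≤ 1) ∧
      |∑ j ∈ Finset.range k, (((2 : ℕ) : ℝ) ^ (j + 1))⁻¹ * d j - β| ≤ ((2 : ℝ) ^ k)⁻¹ := by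
  induction k generalizing β with
  | zero => exact ⟨fun _ => 0, fun _ => zero_le_one, by simpa [abs_of_nonneg h0] using h1⟩
  | succ k ih =>
    -- Doubling and subtracting the leading bit keeps the remainder in the closed interval `[0, 1]`,
    -- so `β = 1` needs no separate case.
    obtain ⟨b, hb, hb0, hb1⟩ : ∃ b : ℕ, b ≤ 1 ∧ 0 ≤ 2 * β - b ∧ 2 * β - b ≤ 1 := by
      rcases le_total β (1 / 2) with h | h
      · exact ⟨0, zero_le_one, by push_cast; linarith, by push_cast; linarith⟩
      · exact ⟨1, le_rfl, by push_cast; linarith, by push_cast; linarith⟩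
    obtain ⟨d, hd, hsum⟩ := ih hb0 hb1
    refine ⟨fun j => Nat.casesOn j b d, fun j => by cases j <;> simp [hb, hd], ?_⟩
    rw [Finset.sum_range_succ']
    have h : ∑ j ∈ Finset.range k, (((2 : ℕ) : ℝ) ^ (j + 1 + 1))⁻¹ * (d j : ℝ) =
        (∑ j ∈ Finset.range k, (((2 : ℕ) : ℝ) ^ (j + 1))⁻¹ * (d j : ℝ)) / 2 := by
      rw [Finset.sum_div]
      refine Finset.sum_congr rfl fun j _ => ?_
      rw [pow_succ _ (j + 1)]
      push_cast
      field_simp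
    have h' : ∑ j ∈ Finset.range k, (((2 : ℕ) : ℝ) ^ (j + 1 + 1))⁻¹ * (d j : ℝ) +
        (((2 : ℕ) : ℝ) ^ (0 + 1))⁻¹ * (b : ℝ) - β =
        (∑ j ∈ Finset.range k, (((2 : ℕ) : ℝ) ^ (j + 1))⁻¹ * (d j : ℝ) - (2 * β - b)) / 2 := by
      rw [h]; push_cast; ring
    change |∑ j ∈ Finset.range k, (((2 : ℕ) : ℝ) ^ (j + 1 + 1))⁻¹ * (d j : ℝ) +
        (((2 : ℕ) : ℝ) ^ (0 + 1))⁻¹ * (b : ℝ) - β| ≤ _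
    rw [h', abs_div, abs_two, pow_succ, mul_inv, div_eq_mul_inv]
    exact mul_le_mul_of_nonneg_right hsum (by norm_num)

/-- The base-4 digits of `v` are `2 * D l`, thus 0 or 2. After a shift by `l` places the remainder
lies on the plateau of `plateauWave` with value `D l`. -/
theorem exists_quaternary_number (L : ℕ) (D : ℕ → ℕ) (hD : ∀ l, D l ≤ 1) :
    ∃ v : ℝ, ∃ T : ℕ, v * 4 ^ L = T ∧ 0 ≤ v ∧ v ≤ 1 ∧ ∀ l < L, ∃ z : ℤ, ∃ w : ℝ,
      4 ^ l * v = z + w ∧ (D l : ℝ) / 2 ≤ w ∧ w ≤ D l / 2 + 1 / 4 := by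
  induction L generalizing D with
  | zero => exact ⟨0, 0, by simp, le_rfl, zero_le_one, fun l hl => absurd hl (Nat.not_lt_zero l)⟩
  | succ L ih =>
    obtain ⟨v, T, hT, hv0, hv1, h⟩ := ih (fun l => D (l + 1)) fun l => hD _
    have hD0 : (D 0 : ℝ) ≤ 1 := by exact_mod_cast hD 0
    have hD0' : (0 : ℝ) ≤ D 0 := by positivity
    refine ⟨(2 * D 0 + v) / 4, 2 * D 0 * 4 ^ L + T, ?_, by linarith, by linarith, fun l hl => ?_⟩
    · push_cast
      rw [← hT, pow_succ]
      ring
    · cases l with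
      | zero => exact ⟨0, (2 * D 0 + v) / 4, by simp, by linarith, by linarith⟩
      | succ l =>
        obtain ⟨z, w, hw, h1, h2⟩ := h l (by omega)
        refine ⟨2 * D 0 * 4 ^ l + z, w, ?_, h1, h2⟩
        push_cast
        rw [pow_succ, add_assoc, ← hw]
        ring

/-- The curve passes close to every point, at a parameter with a small denominator. -/
theorem exists_curveApprox_near {n : ℕ} {N : ℕ} (hN : 0 < N) {a : ℕ → ℝ}
    (ha : ∀ i < n, |a i| ≤ N) (k : ℕ) :
    ∃ T : ℕ, (N : ℝ) ≤ T / 4 ^ (n * k + 1) ∧ (T : ℝ) / 4 ^ (n * k + 1) ≤ N + 1 ∧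
      ∀ i < n, |curveApprox n k i ((T : ℝ) / 4 ^ (n * k + 1)) - a i| ≤
        2 * N * ((2 : ℝ) ^ k)⁻¹ := by
  have hN' : (0 : ℝ) < N := by exact_mod_cast hN
  have hbits : ∀ i, ∃ d : ℕ → ℕ, (∀ j, d j ≤ 1) ∧ (i < n →
      |∑ j ∈ Finset.range k, (((2 : ℕ) : ℝ) ^ (j + 1))⁻¹ * d j - (a i / N + 1) / 2| ≤
        ((2 : ℝ) ^ k)⁻¹) := by
    intro i
    by_cases hi : i < n
    · have h := abs_le.mp (ha i hi)
      have h1 : -1 ≤ a i / N := by rw [le_div_iff₀ hN']; linarith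
      have h2 : a i / N ≤ 1 := by rw [div_le_iff₀ hN']; linarith
      obtain ⟨d, hd, hs⟩ := exists_binary_digits k (β := (a i / N + 1) / 2) (by linarith)
        (by linarith)
      exact ⟨d, hd, fun _ => hs⟩
    · exact ⟨fun _ => 0, fun _ => zero_le_one, fun h => absurd h hi⟩
  choose d hd hsum using hbits
  -- The bits of the `n` coordinates are interleaved: place `n * j + i` carries bit `j` of
  -- coordinate `i`.
  obtain ⟨v, T, hT, hv0, hv1, hdig⟩ :=
    exists_quaternary_number (n * k) (fun l => d (l % n) (l / n)) fun l => hd _ _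
  have ht : ((N * 4 ^ (n * k + 1) + T : ℕ) : ℝ) / 4 ^ (n * k + 1) = N + v / 4 := by
    push_cast
    rw [← hT, pow_succ]
    field_simp
  refine ⟨N * 4 ^ (n * k + 1) + T, ?_⟩
  rw [ht]
  refine ⟨by linarith, by linarith, fun i hi => ?_⟩
  -- On the first quarter after `N` the wave equals `v / 4`, so the amplitude is constantly `N`
  -- there; this is why `v` is divided by 4 and one more power of 4 appears.
  have htri : triangleWave ((N : ℝ) + v / 4) = v / 4 := by
    unfold triangleWave
    rw [abs_sub_round_eq_min, Int.fract_natCast_add,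
      Int.fract_eq_self.mpr ⟨by linarith, by linarith⟩, min_eq_left (by linarith)]
  have hcs : curveSum n k i ((N : ℝ) + v / 4) =
      ∑ j ∈ Finset.range k, (((2 : ℕ) : ℝ) ^ (j + 1))⁻¹ * d i j := by
    refine Finset.sum_congr rfl fun j hj => ?_
    have hl : n * j + i < n * k := by
      have : n * (j + 1) ≤ n * k := Nat.mul_le_mul_left n (Finset.mem_range.mp hj)
      rw [Nat.mul_succ] at this
      omega
    obtain ⟨z, w, hw, h1, h2⟩ := hdig _ hl
    have hmod : (n * j + i) % n = i := by rw [Nat.mul_add_mod, Nat.mod_eq_of_lt hi]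
    have hdiv : (n * j + i) / n = j := by
      rw [Nat.mul_add_div (by omega), Nat.div_eq_of_lt hi, add_zero]
    simp only [hmod, hdiv] at h1 h2
    have harg : ((4 : ℕ) : ℝ) ^ (n * j + i + 1) * ((N : ℝ) + v / 4) =
        ((N * 4 ^ (n * j + i + 1) + z : ℤ) : ℝ) + w := by
      push_cast
      rw [pow_succ]
      linear_combination hw
    rw [harg]
    congr 1
    rcases Nat.le_one_iff_eq_zero_or_eq_one.mp (hd i j) with h | h
    · rw [h] at h1 h2 ⊢
      push_cast at h1 h2 ⊢
      rw [← plateauWave_eq_zero (N * 4 ^ (n * j + i + 1) + z) (w := w) (by linarith)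
        (by linarith)]
      push_cast
      rfl
    · rw [h] at h1 h2 ⊢
      push_cast at h1 h2 ⊢
      rw [← plateauWave_eq_one (N * 4 ^ (n * j + i + 1) + z) (w := w) (by linarith)
        (by linarith)]
      push_cast
      rfl
  unfold curveApprox
  rw [htri, hcs]
  have h := hsum i hi
  have heq : ((N : ℝ) + v / 4 - v / 4) * (2 * (∑ j ∈ Finset.range k,
      (((2 : ℕ) : ℝ) ^ (j + 1))⁻¹ * (d i j : ℝ)) - 1) - a i =
      2 * N * (∑ j ∈ Finset.range k, (((2 : ℕ) : ℝ) ^ (j + 1))⁻¹ * (d i j : ℝ) -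
        (a i / N + 1) / 2) := by
    field_simp
    ring
  rw [heq, abs_mul, abs_of_nonneg (by positivity)]
  exact mul_le_mul_of_nonneg_left h (by positivity)

end Curve

/-! ### From projections to accumulation points -/

section Projection

/-- The point of `ℝⁿ` with parameter `t` on the curve `curveLimit n`. -/
noncomputable def curvePoint (n : ℕ) (t : ℝ) : EuclideanSpace ℝ (Fin n) :=
  WithLp.toLp 2 fun i => curveLimit n i t

/-- The point with parameter `t` on the `J`-th approximating curve. -/
noncomputable def curveApproxPoint (n J : ℕ) (t : ℝ) : EuclideanSpace ℝ (Fin n) :=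
  WithLp.toLp 2 fun i => curveApprox n J i t

/-! ### Computability of the curve -/

theorem EuclideanSpace.dist_le_of_forall_abs_le {n : ℕ} {y z : EuclideanSpace ℝ (Fin n)} {δ : ℝ}
    (h : ∀ i, |y i - z i| ≤ δ) : dist y z ≤ n * δ := by
  rw [dist_eq_norm]
  refine (EuclideanSpace.norm_le_sum_abs _).trans ?_
  simpa using Finset.sum_le_card_nsmul Finset.univ _ δ fun i _ => h i

/-- Since `B ≤ 2 ^ B`, spending `B` extra bits absorbs a factor `B`, which avoids logarithms in the
moduli. -/
theorem natCast_mul_inv_two_pow_le (B e : ℕ) :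
    (B : ℝ) * ((2 : ℝ) ^ (B + e))⁻¹ ≤ ((2 : ℝ) ^ e)⁻¹ := by
  have h : (B : ℝ) ≤ 2 ^ B := by exact_mod_cast Nat.lt_two_pow_self.le
  rw [pow_add, mul_inv, ← mul_assoc]
  refine mul_le_of_le_one_left (by positivity) ?_
  rw [← div_eq_mul_inv]
  exact div_le_one_of_le₀ h (by positivity)

/-- Parameters read off from a sufficiently good approximation determine the curve. -/
theorem dist_curveApproxPoint_curvePoint_le {n B J I m : ℕ} {q t : ℝ} (hB : |t| + 1 ≤ B)
    (hJ : J = B + (n + (m + 3))) (hI : I = B + (2 * (n * J) + (n + (m + 6))))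
    (hq : |q - t| ≤ ((2 : ℝ) ^ I)⁻¹) :
    dist (curveApproxPoint n J q) (curvePoint n t) ≤ ((2 : ℝ) ^ (m + 1))⁻¹ := by
  have hcoord : ∀ i : Fin n, |curveApproxPoint n J q i - curvePoint n t i| ≤
      ((2 : ℝ) ^ (n + (m + 1)))⁻¹ := by
    intro i
    have h1 := abs_curveApprox_sub_le (J := J) i.2 q t
    have h2 := abs_curveApprox_sub_curveLimit_le n J i t
    have h3 := abs_sub_le (curveApprox n J i q) (curveApprox n J i t) (curveLimit n i t)
    have hB1 : (1 : ℝ) ≤ B := by linarith [abs_nonneg t]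
    have h4 : 2 * (|t| + 1) * ((2 : ℝ) ^ J)⁻¹ ≤ 2 * ((2 : ℝ) ^ (n + (m + 3)))⁻¹ := by
      have := natCast_mul_inv_two_pow_le B (n + (m + 3))
      rw [← hJ] at this
      have h5 : (|t| + 1) * ((2 : ℝ) ^ J)⁻¹ ≤ B * ((2 : ℝ) ^ J)⁻¹ := by gcongr
      linarith
    have h5 : (2 + 8 * (|t| + 1) * 4 ^ (n * J)) * |q - t| ≤
        16 * ((2 : ℝ) ^ (n + (m + 6)))⁻¹ := by
      have h6 : (1 : ℝ) ≤ 4 ^ (n * J) := one_le_pow₀ (by norm_num)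
      have h7 : 2 + 8 * (|t| + 1) * 4 ^ (n * J) ≤ 16 * (B * (4 : ℝ) ^ (n * J)) := by
        have : (1 : ℝ) ≤ B * 4 ^ (n * J) := one_le_mul_of_one_le_of_one_le hB1 h6
        have : 8 * (|t| + 1) * (4 : ℝ) ^ (n * J) ≤ 8 * B * 4 ^ (n * J) := by gcongr
        linarith
      have h8 := natCast_mul_inv_two_pow_le B (2 * (n * J) + (n + (m + 6)))
      rw [← hI] at h8
      have h9 : (4 : ℝ) ^ (n * J) * ((2 : ℝ) ^ (2 * (n * J) + (n + (m + 6))))⁻¹ =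
          ((2 : ℝ) ^ (n + (m + 6)))⁻¹ := by
        rw [show (4 : ℝ) = 2 ^ 2 by norm_num, ← pow_mul, pow_add, mul_inv, ← mul_assoc,
          mul_inv_cancel₀ (by positivity), one_mul]
      calc _ ≤ 16 * (B * (4 : ℝ) ^ (n * J)) * ((2 : ℝ) ^ I)⁻¹ := by gcongr
        _ = 16 * ((4 : ℝ) ^ (n * J) * (B * ((2 : ℝ) ^ I)⁻¹)) := by ring
        _ ≤ 16 * ((4 : ℝ) ^ (n * J) * ((2 : ℝ) ^ (2 * (n * J) + (n + (m + 6))))⁻¹) := by gcongr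
        _ = _ := by rw [h9]
    -- The offsets 6 and 3 give the parameter error and the truncation error half of the tolerance
    -- each.
    have h6 : 16 * ((2 : ℝ) ^ (n + (m + 6)))⁻¹ + 2 * ((2 : ℝ) ^ (n + (m + 3)))⁻¹ ≤
        ((2 : ℝ) ^ (n + (m + 1)))⁻¹ := by
      rw [show n + (m + 6) = n + (m + 1) + 5 by ring, show n + (m + 3) = n + (m + 1) + 2 by ring,
        pow_add (2 : ℝ) (n + (m + 1)) 5, pow_add (2 : ℝ) (n + (m + 1)) 2, mul_inv, mul_inv]
      have : (0 : ℝ) ≤ ((2 : ℝ) ^ (n + (m + 1)))⁻¹ := by positivity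
      generalize ((2 : ℝ) ^ (n + (m + 1)))⁻¹ = u at *
      norm_num
      linarith
    change |curveApprox n J i q - curveLimit n i t| ≤ _
    linarith
  exact (EuclideanSpace.dist_le_of_forall_abs_le hcoord).trans
    (natCast_mul_inv_two_pow_le n (m + 1))

/-- The curve is computable. -/
theorem exists_computable_curvePoint (n : ℕ) : ∃ K : (ℕ → ℕ) → ℕ → ℕ,
    BaireComputable (PFun.lift K) ∧ ∀ p t, realSeq.cauchyRep.IsName p t →
      (euclideanSeq n).cauchyRep.IsName (K p) (curvePoint n t) := by
  obtain ⟨f, hf, hfeq⟩ : PrimrecRat fun x : (ℕ × ℕ) × ℕ =>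
      curveApprox n x.1.1 x.2 (ratEnum x.1.2) :=
    PrimrecRat.curveApprox n (Primrec.fst.comp Primrec.fst) Primrec.snd
      (PrimrecRat.ratEnum.comp (Primrec.snd.comp Primrec.fst))
  obtain ⟨c, hc, hceq⟩ := exists_primrec_tupleCode n (f := fun (x : ℕ × ℕ) i => f (x, i)) hf
  have hcpt : ∀ J e, (euclideanSeq n).pt (c (J, e)) = curveApproxPoint n J (ratEnum e : ℝ) := by
    intro J e
    ext i
    rw [euclideanSeq_pt_apply, hceq _ _ i.2, hfeq, ratCast_curveApprox]
    rfl
  -- The first rational has modulus at most `p 0` and is within 1 of `t`, so `|t| + 1 ≤ p 0 + 2`.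
  let B : ℕ → ℕ → ℕ := fun _ a => a + 2
  let J : ℕ → ℕ → ℕ := fun m a => B m a + (n + (m + 3))
  let I : ℕ → ℕ → ℕ := fun m a => B m a + (2 * (n * J m a) + (n + (m + 6)))
  have hB : Primrec₂ B := Primrec.nat_add.comp₂ Primrec₂.right (Primrec₂.const 2)
  have hconst : ∀ r : ℕ, Primrec₂ fun m _ : ℕ => n + (m + r) := fun r =>
    Primrec.nat_add.comp₂ (Primrec₂.const n)
      (Primrec.nat_add.comp₂ Primrec₂.left (Primrec₂.const r))
  have hJ : Primrec₂ J := Primrec.nat_add.comp₂ hB (hconst 3)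
  have hI : Primrec₂ I := Primrec.nat_add.comp₂ hB (Primrec.nat_add.comp₂
    (Primrec.nat_mul.comp₂ (Primrec₂.const 2) (Primrec.nat_mul.comp₂ (Primrec₂.const n) hJ))
    (hconst 6))
  refine ⟨fun p m => c (J m (p 0), p (I m (p 0))), ?_, fun p t hp => ?_⟩
  · have h0 : Primrec fun x : ℕ × List ℕ => x.2.getD 0 0 :=
      (Primrec.list_getD 0).comp Primrec.snd (Primrec.const 0)
    have hg : Primrec₂ fun (m : ℕ) (l : List ℕ) =>
        c (J m (l.getD 0 0), l.getD (I m (l.getD 0 0)) 0) :=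
      hc.comp ((hJ.comp Primrec.fst h0).pair
        ((Primrec.list_getD 0).comp Primrec.snd (hI.comp Primrec.fst h0)))
    have key : (fun (p : ℕ → ℕ) m => c (J m (p 0), p (I m (p 0)))) = fun p m =>
        c (J m ((initialWord p (I m (p 0) + 1)).getD 0 0), (initialWord p (I m (p 0) + 1)).getD
          (I m ((initialWord p (I m (p 0) + 1)).getD 0 0)) 0) := by
      funext p m
      rw [initialWord_getD p (Nat.succ_pos _), initialWord_getD p (Nat.lt_succ_self _)]
    rw [key]
    exact baireComputable_lift_of_initialWord (len := fun m a => I m a + 1)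
      (Primrec.succ.comp₂ hI) hg
  · refine (euclideanSeq n).isName_of_dist_le fun m => ?_
    rw [hcpt, inv_pow]
    refine dist_curveApproxPoint_curvePoint_le (B := B m (p 0)) ?_ rfl rfl ?_
    · have h1 := realSeq.dist_le_of_isName hp 0
      have h1' : |(ratEnum (p 0) : ℝ) - t| ≤ 1 := by rwa [pow_zero] at h1
      have h2 : |(ratEnum (p 0) : ℝ)| ≤ p 0 := by exact_mod_cast abs_ratEnum_le (p 0)
      have h3 := abs_sub_abs_le_abs_sub t (ratEnum (p 0) : ℝ)
      rw [abs_sub_comm] at h3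
      simp only [B]
      push_cast
      linarith
    · have h := realSeq.dist_le_of_isName hp (I m (p 0))
      rwa [inv_pow] at h

/-- The `T`-th parameter of level `k`. -/
def gridParam (n k T : ℕ) : ℚ := (T : ℚ) * (((4 : ℕ) : ℚ) ^ (n * k + 1))⁻¹

/-- Squared distance between the point of the `k`-th approximating curve with the `T`-th parameter
and the `c`-th rational point. -/
def gridDistSq (n k T c : ℕ) : ℚ :=
  ∑ i ∈ Finset.range n, (curveApprox n k i (gridParam n k T) - ratEnum (tupleEntry c i)) ^ 2

/-- The point with the `T`-th parameter avoids the first `k` balls, up to a small error, and the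
parameter is not too large. -/
def Admissible (n : ℕ) (p : ℕ → ℕ) (k T : ℕ) : Prop :=
  (∀ i < k, nnratEnum (p (2 * i + 1)).unpair.2 ≤ ((1 : ℕ) : ℚ) / ((k : ℚ) + 1) ∨
    (nnratEnum (p (2 * i + 1)).unpair.2 - ((1 : ℕ) : ℚ) / ((k : ℚ) + 1)) ^ 2 ≤
      gridDistSq n k T (p (2 * i + 1)).unpair.1) ∧
  gridParam n k T ^ 2 ≤ 2 * gridDistSq n k T 0 + 32

/-- Number of the largest parameter of level `k`. -/
def gridBound (n k : ℕ) : ℕ := k * 4 ^ (n * k + 1)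

/-- Among the admissible parameters, the `T`-th gives a smallest distance to the centre. -/
def Optimal (n : ℕ) (p : ℕ → ℕ) (k T : ℕ) : Prop :=
  Admissible n p k T ∧ ∀ T' < gridBound n k + 1, Admissible n p k T' →
    gridDistSq n k T (p (2 * k)) ≤ gridDistSq n k T' (p (2 * k))

open Classical in
/-- An optimal parameter of level `k`, if there is one. -/
noncomputable def optimalParam (n : ℕ) (p : ℕ → ℕ) (k : ℕ) : ℕ :=
  Nat.findGreatest (Optimal n p k) (gridBound n k)

theorem optimalParam_congr (n : ℕ) {p p' : ℕ → ℕ} {k : ℕ} (h : ∀ e ≤ 2 * k, p e = p' e) :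
    optimalParam n p k = optimalParam n p' k := by
  have hadm : Admissible n p k = Admissible n p' k := by
    funext T
    unfold Admissible
    refine propext (and_congr_left fun _ => forall_congr' fun i => imp_congr_right fun hi => ?_)
    rw [h _ (by omega)]
  have hopt : Optimal n p k = Optimal n p' k := by
    funext T
    unfold Optimal
    rw [hadm, h _ le_rfl]
  unfold optimalParam
  rw [hopt]

/-! ### Primitive recursiveness of the grid search -/

section Primrec

variable {α : Type*} [Primcodable α]

theorem primrec_gridExponent (n : ℕ) {k : α → ℕ} (hk : Primrec k) :
    Primrec fun x => n * k x + 1 :=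
  Primrec.succ.comp (Primrec.nat_mul.comp (Primrec.const n) hk)

theorem PrimrecRat.gridParam (n : ℕ) {k T : α → ℕ} (hk : Primrec k) (hT : Primrec T) :
    PrimrecRat fun x => gridParam n (k x) (T x) :=
  (PrimrecRat.natCast hT).mul
    (PrimrecRat.inv_natCast_pow 4 (by norm_num) (primrec_gridExponent n hk))

theorem PrimrecRat.gridDistSq (n : ℕ) {k T c : α → ℕ} (hk : Primrec k) (hT : Primrec T)
    (hc : Primrec c) : PrimrecRat fun x => gridDistSq n (k x) (T x) (c x) := by
  refine PrimrecRat.sum_range ?_ (Primrec.const n)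
  have h1 : PrimrecRat fun y : α × ℕ => _root_.curveApprox n (k y.1) y.2
      (_root_.gridParam n (k y.1) (T y.1)) :=
    PrimrecRat.curveApprox n (hk.comp Primrec.fst) Primrec.snd
      (PrimrecRat.gridParam n (hk.comp Primrec.fst) (hT.comp Primrec.fst))
  have h2 : PrimrecRat fun y : α × ℕ => _root_.ratEnum (tupleEntry (c y.1) y.2) :=
    PrimrecRat.ratEnum.comp (primrec_tupleEntry.comp (hc.comp Primrec.fst) Primrec.snd)
  exact (h1.sub h2).sq

theorem primrec_gridBound (n : ℕ) {k : α → ℕ} (hk : Primrec k) :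
    Primrec fun x => gridBound n (k x) :=
  Primrec.nat_mul.comp hk (Primrec.nat_pow_comp (Primrec.const 4) (primrec_gridExponent n hk))

theorem primrecPred_admissible (n : ℕ) {l : α → List ℕ} {k T : α → ℕ} (hl : Primrec l)
    (hk : Primrec k) (hT : Primrec T) :
    PrimrecPred fun x => Admissible n (fun e => (l x).getD e 0) (k x) (T x) := by
  have hk' : Primrec fun y : α × ℕ => k y.1 := hk.comp Primrec.fst
  have hT' : Primrec fun y : α × ℕ => T y.1 := hT.comp Primrec.fst
  have hp : Primrec fun y : α × ℕ => ((l y.1).getD (2 * y.2 + 1) 0).unpair :=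
    Primrec.unpair.comp ((Primrec.list_getD 0).comp (hl.comp Primrec.fst)
      (Primrec.nat_double_succ.comp Primrec.snd))
  have hr : PrimrecRat fun y : α × ℕ => nnratEnum ((l y.1).getD (2 * y.2 + 1) 0).unpair.2 :=
    PrimrecRat.nnratEnum.comp (Primrec.snd.comp hp)
  have hε : PrimrecRat fun y : α × ℕ => ((1 : ℕ) : ℚ) / ((k y.1 : ℚ) + 1) :=
    PrimrecRat.natCast_div (Primrec.const 1) hk'
  have hd : PrimrecRat fun y : α × ℕ => gridDistSq n (k y.1) (T y.1)
      ((l y.1).getD (2 * y.2 + 1) 0).unpair.1 :=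
    PrimrecRat.gridDistSq n hk' hT' (Primrec.fst.comp hp)
  have hlast : PrimrecPred fun x => gridParam n (k x) (T x) ^ 2 ≤
      2 * gridDistSq n (k x) (T x) 0 + 32 :=
    (PrimrecRat.gridParam n hk hT).sq.le (((PrimrecRat.const 2).mul
      (PrimrecRat.gridDistSq n hk hT (Primrec.const 0))).add (PrimrecRat.const 32))
  exact (PrimrecPred.forall_lt_comp ((hr.le hε).or ((hr.sub hε).sq.le hd)) hk).and hlast

theorem primrecPred_optimal (n : ℕ) {l : α → List ℕ} {k T : α → ℕ} (hl : Primrec l)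
    (hk : Primrec k) (hT : Primrec T) :
    PrimrecPred fun x => Optimal n (fun e => (l x).getD e 0) (k x) (T x) := by
  have hp : Primrec fun x => (l x).getD (2 * k x) 0 :=
    (Primrec.list_getD 0).comp hl (Primrec.nat_double.comp hk)
  have hk' : Primrec fun y : α × ℕ => k y.1 := hk.comp Primrec.fst
  have hp' : Primrec fun y : α × ℕ => (l y.1).getD (2 * k y.1) 0 := hp.comp Primrec.fst
  have hle : PrimrecPred fun y : α × ℕ =>
      gridDistSq n (k y.1) (T y.1) ((l y.1).getD (2 * k y.1) 0) ≤
        gridDistSq n (k y.1) y.2 ((l y.1).getD (2 * k y.1) 0) :=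
    (PrimrecRat.gridDistSq n hk' (hT.comp Primrec.fst) hp').le
      (PrimrecRat.gridDistSq n hk' Primrec.snd hp')
  exact (primrecPred_admissible n hl hk hT).and (PrimrecPred.forall_lt_comp
    ((primrecPred_admissible n (hl.comp Primrec.fst) hk' Primrec.snd).imp hle)
    (Primrec.succ.comp (primrec_gridBound n hk)))

theorem primrec_optimalParam (n : ℕ) {l : α → List ℕ} {k : α → ℕ} (hl : Primrec l)
    (hk : Primrec k) : Primrec fun x => optimalParam n (fun e => (l x).getD e 0) (k x) := by
  classical
  unfold optimalParam
  refine Primrec.nat_findGreatest (p := fun x T => Optimal n (fun e => (l x).getD e 0) (k x) T)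
    (primrec_gridBound n hk) ?_
  exact (primrecPred_optimal n (hl.comp Primrec.fst) (hk.comp Primrec.fst)
    Primrec.snd).primrecRel

end Primrec

/-- The sequence of optimal parameters is computable. -/
theorem exists_computable_optimalParam (n : ℕ) : ∃ H : (ℕ → ℕ) → ℕ → ℕ,
    BaireComputable (PFun.lift H) ∧ ∀ p, realSeq.cauchyRep.seq.IsName (H p)
      fun k => (gridParam n k (optimalParam n p k) : ℝ) := by
  obtain ⟨f, hf, hfeq⟩ : PrimrecRat fun x : ℕ × ℕ => gridParam n x.1 x.2 :=
    PrimrecRat.gridParam n Primrec.fst Primrec.snd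
  refine ⟨fun p m => f (m.unpair.1, optimalParam n p m.unpair.1), ?_, fun p k => ?_⟩
  · have hk : Primrec fun x : ℕ × List ℕ => x.1.unpair.1 :=
      Primrec.fst.comp (Primrec.unpair.comp Primrec.fst)
    have hg : Primrec₂ fun (m : ℕ) (l : List ℕ) =>
        f (m.unpair.1, optimalParam n (fun e => l.getD e 0) m.unpair.1) :=
      hf.comp (hk.pair (primrec_optimalParam n Primrec.snd hk))
    have key : (fun (p : ℕ → ℕ) (m : ℕ) => f (m.unpair.1, optimalParam n p m.unpair.1)) =
        fun p m => f (m.unpair.1,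
          optimalParam n (fun e => (initialWord p (2 * m + 1)).getD e 0) m.unpair.1) := by
      funext p m
      rw [optimalParam_congr n (p := p) (p' := fun e => (initialWord p (2 * m + 1)).getD e 0)]
      intro e he
      -- The level `m.unpair.1` is at most `m`, and level `k` reads nothing beyond symbol `2 * k`.
      have := Nat.unpair_left_le m
      rw [initialWord_getD]
      omega
    rw [key]
    exact baireComputable_lift_of_initialWord (len := fun m _ => 2 * m + 1)
      (Primrec.nat_double_succ.comp₂ Primrec₂.left) hg
  -- Each term is an exact rational, so its name is constant.
  · refine realSeq.isName_of_dist_le fun i => ?_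
    have : realSeq.pt (f (k, optimalParam n p k)) = (gridParam n k (optimalParam n p k) : ℝ) := by
      change ((ratEnum _ : ℚ) : ℝ) = _
      rw [hfeq]
    simp [this]

/-! ### Admissible parameters and the reduction of projection to accumulation -/

theorem gridDistSq_eq (n k T c : ℕ) : (gridDistSq n k T c : ℝ) =
    dist (curveApproxPoint n k (gridParam n k T : ℝ)) ((euclideanSeq n).pt c) ^ 2 := by
  rw [dist_eq_norm, EuclideanSpace.norm_sq_eq, gridDistSq, Finset.sum_range]
  push_cast
  refine Finset.sum_congr rfl fun i _ => ?_
  rw [ratCast_curveApprox, Real.norm_eq_abs, sq_abs]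
  rfl

theorem gridDistSq_zero_eq (n k T : ℕ) : (gridDistSq n k T 0 : ℝ) =
    ‖curveApproxPoint n k (gridParam n k T : ℝ)‖ ^ 2 := by
  rw [gridDistSq_eq, euclideanSeq_pt_zero, dist_zero_right]

theorem admissible_iff {n : ℕ} {p : ℕ → ℕ} {k T : ℕ} : Admissible n p k T ↔
    (∀ i < k, (nnratEnum (p (2 * i + 1)).unpair.2 : ℝ) - 1 / ((k : ℝ) + 1) ≤
      dist (curveApproxPoint n k (gridParam n k T : ℝ))
        ((euclideanSeq n).pt (p (2 * i + 1)).unpair.1)) ∧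
    (gridParam n k T : ℝ) ^ 2 ≤ 2 * ‖curveApproxPoint n k (gridParam n k T : ℝ)‖ ^ 2 + 32 := by
  unfold Admissible
  refine and_congr (forall_congr' fun i => imp_congr_right fun _ => ?_) ?_
  · rw [← Rat.cast_le (K := ℝ), ← Rat.cast_le (K := ℝ) (p := (_ - _) ^ 2), gridDistSq_eq]
    push_cast
    generalize (nnratEnum (p (2 * i + 1)).unpair.2 : ℝ) = r
    constructor
    · rintro (h | h)
      · exact (sub_nonpos.mpr h).trans dist_nonneg
      · exact le_of_sq_le_sq h dist_nonneg
    · intro h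
      rcases le_total r (1 / ((k : ℝ) + 1)) with h' | h'
      · exact .inl h'
      · exact .inr (pow_le_pow_left₀ (sub_nonneg.mpr h') h 2)
  · rw [← Rat.cast_le (K := ℝ)]
    push_cast
    rw [gridDistSq_zero_eq]

theorem optimal_optimalParam {n : ℕ} {p : ℕ → ℕ} {k T : ℕ} (hT : T ≤ gridBound n k)
    (h : Admissible n p k T) : Optimal n p k (optimalParam n p k) := by
  classical
  obtain ⟨T₀, hT₀, hmin⟩ := Finset.exists_min_image
    ((Finset.range (gridBound n k + 1)).filter (Admissible n p k))
    (fun T => gridDistSq n k T (p (2 * k)))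
    ⟨T, Finset.mem_filter.mpr ⟨Finset.mem_range.mpr (Nat.lt_succ_of_le hT), h⟩⟩
  rw [Finset.mem_filter, Finset.mem_range] at hT₀
  unfold optimalParam
  -- Any minimiser witnesses that an optimal parameter exists; which one `Nat.findGreatest` returns
  -- is irrelevant.
  refine Nat.findGreatest_spec (m := T₀) (Nat.le_of_lt_succ hT₀.1) ⟨hT₀.2, fun T' hT' hadm => ?_⟩
  exact hmin T' (Finset.mem_filter.mpr ⟨Finset.mem_range.mpr hT', hadm⟩)

theorem Optimal.dist_le {n : ℕ} {p : ℕ → ℕ} {k T T' : ℕ} (h : Optimal n p k T)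
    (hT' : T' ≤ gridBound n k) (hadm : Admissible n p k T') :
    dist (curveApproxPoint n k (gridParam n k T : ℝ)) ((euclideanSeq n).pt (p (2 * k))) ≤
      dist (curveApproxPoint n k (gridParam n k T' : ℝ)) ((euclideanSeq n).pt (p (2 * k))) := by
  have h1 := (Rat.cast_le (K := ℝ)).mpr (h.2 T' (Nat.lt_succ_of_le hT') hadm)
  rw [gridDistSq_eq, gridDistSq_eq] at h1
  exact le_of_sq_le_sq h1 dist_nonneg

/-- Points outside all the balls are approximated by admissible points. -/
theorem eventually_exists_admissible {n : ℕ} {p : ℕ → ℕ} {a : EuclideanSpace ℝ (Fin n)}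
    (ha : ∀ i, a ∉ (euclideanSeq n).basicBall (p (2 * i + 1))) :
    ∀ᶠ k in atTop, ∃ T ≤ gridBound n k, Admissible n p k T ∧
      dist (curveApproxPoint n k (gridParam n k T : ℝ)) a ≤ 1 / ((k : ℝ) + 1) := by
  -- The cube of half side `N` contains `a`; the summand 1 makes `N` positive, as the rescaling by
  -- `N` needs.
  set N := ⌈‖a‖⌉₊ + 1 with hN
  have hN1 : ‖a‖ ≤ N := (Nat.le_ceil ‖a‖).trans (by rw [hN]; push_cast; linarith)
  have hN2 : (N : ℝ) ≤ ‖a‖ + 2 := by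
    have := Nat.ceil_lt_add_one (norm_nonneg a)
    rw [hN]
    push_cast
    linarith
  have hlim : Tendsto (fun k : ℕ => n * (2 * N) * ((k : ℝ) * ((2 : ℝ) ^ k)⁻¹ + ((2 : ℝ) ^ k)⁻¹))
      atTop (𝓝 0) := by
    have h1 : Tendsto (fun k : ℕ => (k : ℝ) * ((2 : ℝ) ^ k)⁻¹) atTop (𝓝 0) := by
      simpa using tendsto_self_mul_const_pow_of_lt_one (r := (2 : ℝ)⁻¹) (by norm_num)
        (by norm_num)
    simpa using (h1.add tendsto_inv_two_pow).const_mul ((n : ℝ) * (2 * N))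
  filter_upwards [hlim.eventually (gt_mem_nhds one_pos), eventually_ge_atTop (N + 1)] with k hk hkN
  obtain ⟨T, hT1, hT2, hT⟩ := exists_curveApprox_near (n := n) (Nat.succ_pos _ : 0 < N)
    (a := fun i => if h : i < n then a ⟨i, h⟩ else 0) (fun i hi => by
      rw [dif_pos hi]
      exact (EuclideanSpace.abs_apply_le_norm a ⟨i, hi⟩).trans hN1) k
  have hparam : (gridParam n k T : ℝ) = (T : ℝ) / 4 ^ (n * k + 1) := by
    rw [gridParam]
    push_cast
    rw [div_eq_mul_inv]
  have hkpos : (0 : ℝ) < (k : ℝ) + 1 := by positivity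
  have hdist : dist (curveApproxPoint n k (gridParam n k T : ℝ)) a ≤ 1 / ((k : ℝ) + 1) := by
    have h := EuclideanSpace.dist_le_of_forall_abs_le
      (y := curveApproxPoint n k (gridParam n k T : ℝ)) (z := a) (δ := 2 * N * ((2 : ℝ) ^ k)⁻¹)
      fun i => by
        have := hT i i.2
        simp only [i.2, dite_true] at this
        rw [hparam]
        exact this
    refine h.trans ?_
    rw [le_div_iff₀ hkpos]
    linarith
  have hε : 1 / ((k : ℝ) + 1) ≤ 1 := by
    rw [div_le_one hkpos]
    linarith [(Nat.cast_nonneg k : (0 : ℝ) ≤ k)]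
  refine ⟨T, ?_, admissible_iff.mpr ⟨fun i _ => ?_, ?_⟩, hdist⟩
  · have h1 : (T : ℝ) / 4 ^ (n * k + 1) ≤ k := hT2.trans (by exact_mod_cast hkN)
    rw [div_le_iff₀ (by positivity)] at h1
    exact_mod_cast h1
  · have h1 := ha i
    rw [DenseSequence.basicBall, Metric.mem_ball, not_lt] at h1
    have h2 := dist_triangle_left a ((euclideanSeq n).pt (p (2 * i + 1)).unpair.1)
      (curveApproxPoint n k (gridParam n k T : ℝ))
    linarith
  · have h1 : ‖a‖ ≤ ‖curveApproxPoint n k (gridParam n k T : ℝ)‖ + 1 := by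
      rw [dist_comm, dist_eq_norm] at hdist
      linarith [norm_le_norm_add_norm_sub' a (curveApproxPoint n k (gridParam n k T : ℝ))]
    have h2 : (0 : ℝ) ≤ (gridParam n k T : ℝ) := by rw [hparam]; positivity
    have h3 : (gridParam n k T : ℝ) ≤ ‖curveApproxPoint n k (gridParam n k T : ℝ)‖ + 4 := by
      rw [← hparam] at hT2
      linarith
    have h4 := pow_le_pow_left₀ h2 h3 2
    -- With `y` the norm of the curve point, the parameter is at most `y + 4`, and `(y + 4)² ≤ 2 y²
    -- + 32` because `(y - 4)² ≥ 0`.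
    linarith [sq_nonneg (‖curveApproxPoint n k (gridParam n k T : ℝ)‖ - 4)]

theorem projNeg_reducible_bwt (n : ℕ) :
    StrongWeihrauchReducible (projNeg (euclideanSeq n)) (BWT realSeq) := by
  obtain ⟨H, hH, hHname⟩ := exists_computable_optimalParam n
  obtain ⟨K, hK, hKname⟩ := exists_computable_curvePoint n
  refine .of_lift hH hK ?_
  rintro p ⟨x, A⟩ ⟨hx, hA⟩ ⟨a, ha, hdist⟩
  change EuclideanSpace ℝ (Fin n) at x
  change EuclideanSpace ℝ (Fin n) at a
  change Closeds (EuclideanSpace ℝ (Fin n)) at A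
  replace hx : (euclideanSeq n).cauchyRep.IsName (fun i => p (2 * i)) x := hx
  replace hA : (A : Set (EuclideanSpace ℝ (Fin n))) =
    (⋃ i, (euclideanSeq n).basicBall (p (2 * i + 1)))ᶜ := hA
  replace ha : a ∈ A := ha
  replace hdist : dist x a = Metric.infDist x (A : Set (EuclideanSpace ℝ (Fin n))) := hdist
  have hmem : ∀ z, z ∈ A ↔ ∀ i, z ∉ (euclideanSeq n).basicBall (p (2 * i + 1)) := by
    intro z
    rw [← SetLike.mem_coe, hA]
    simp
  set s : ℕ → ℝ := fun k => (gridParam n k (optimalParam n p k) : ℝ) with hs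
  have hε : Tendsto (fun k : ℕ => 1 / ((k : ℝ) + 1)) atTop (𝓝 0) :=
    tendsto_one_div_add_atTop_nhds_zero_nat
  -- The centre `x` is replaced by its `k`-th approximation on both sides of the comparison, whence
  -- the error `2 · 2⁻ᵏ`.
  have hopt : ∀ᶠ k in atTop, Admissible n p k (optimalParam n p k) ∧
      dist (curveApproxPoint n k (s k)) x ≤
        1 / ((k : ℝ) + 1) + dist x a + 2 * ((2 : ℝ) ^ k)⁻¹ := by
    filter_upwards [eventually_exists_admissible ((hmem a).mp ha)] with k hk
    obtain ⟨T, hT, hadm, hd⟩ := hk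
    have ho := optimal_optimalParam hT hadm
    refine ⟨ho.1, ?_⟩
    have h1 := ho.dist_le hT hadm
    have h2 := (euclideanSeq n).dist_le_of_isName hx k
    rw [inv_pow] at h2
    have h3 := dist_triangle (curveApproxPoint n k (s k)) ((euclideanSeq n).pt (p (2 * k))) x
    have h4 := dist_triangle4_right (curveApproxPoint n k (gridParam n k T : ℝ))
      ((euclideanSeq n).pt (p (2 * k))) a x
    have h5 := dist_comm x a
    simp only [hs] at h3 ⊢
    linarith
  have hlim : Tendsto (fun k : ℕ => 1 / ((k : ℝ) + 1) + dist x a + 2 * ((2 : ℝ) ^ k)⁻¹) atTop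
      (𝓝 (dist x a)) := by
    simpa using (hε.add_const (dist x a)).add (tendsto_inv_two_pow.const_mul 2)
  have hcomp : IsCompact (closure (Set.range s)) := by
    -- Levels without admissible parameters, where the default 0 is output, are finite in number; an
    -- eventual bound is enough for a sequence.
    have hbdd : IsBoundedUnder (· ≤ ·) atTop fun k => |s k| := by
      obtain ⟨C, hC⟩ := hlim.bddAbove_range
      refine ⟨2 * (‖x‖ + C) ^ 2 + 33, ?_⟩
      rw [eventually_map]
      filter_upwards [hopt] with k hk
      have h1 := (admissible_iff.mp hk.1).2
      have h2 : dist (curveApproxPoint n k (s k)) x ≤ C := hk.2.trans (hC ⟨k, rfl⟩)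
      have h3 : ‖curveApproxPoint n k (s k)‖ ≤ ‖x‖ + C := by
        rw [dist_eq_norm] at h2
        linarith [norm_le_norm_add_norm_sub' (curveApproxPoint n k (s k)) x]
      have h4 := pow_le_pow_left₀ (norm_nonneg _) h3 2
      have h5 : |s k| ≤ s k ^ 2 + 1 := by
        rw [← sq_abs (s k)]
        nlinarith [sq_nonneg (|s k| - 1), abs_nonneg (s k)]
      have h6 : s k ^ 2 ≤ 2 * ‖curveApproxPoint n k (s k)‖ ^ 2 + 32 := h1
      linarith
    obtain ⟨C, hC⟩ := hbdd.bddAbove_range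
    refine (isBounded_iff_forall_norm_le.mpr ⟨C, ?_⟩).isCompact_closure
    rintro _ ⟨k, rfl⟩
    exact hC ⟨k, rfl⟩
  refine ⟨s, hHname p, ?_, ?_⟩
  · obtain ⟨t, -, φ, hφ, ht⟩ := hcomp.tendsto_subseq fun k => subset_closure (Set.mem_range_self k)
    exact ⟨t, hcomp, ht.mapClusterPt.of_comp hφ.tendsto_atTop⟩
  · intro q (t : ℝ) ⟨_, ht⟩ hq
    refine ⟨curvePoint n t, ?_, hKname q t hq⟩
    obtain ⟨φ, hφ, hφt⟩ := ht.tendsto_subseq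
    have hφ' := hφ.tendsto_atTop
    have hY : Tendsto (fun k => curveApproxPoint n (φ k) (s (φ k))) atTop
        (𝓝 (curvePoint n t)) := by
      refine ((PiLp.continuous_toLp 2 _).tendsto _).comp (tendsto_pi_nhds.mpr fun i => ?_)
      exact tendsto_curveApprox i.2 hφt hφ'
    have hA' : curvePoint n t ∈ A := by
      rw [hmem]
      intro i
      have h : (nnratEnum (p (2 * i + 1)).unpair.2 : ℝ) - 0 ≤
          dist (curvePoint n t) ((euclideanSeq n).pt (p (2 * i + 1)).unpair.1) := by
        refine le_of_tendsto_of_tendsto (tendsto_const_nhds.sub (hε.comp hφ'))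
          (hY.dist tendsto_const_nhds) ?_
        -- A fixed ball `i` is tested at all levels above `i`, with a tolerance that vanishes in the
        -- limit.
        filter_upwards [hφ'.eventually hopt, hφ'.eventually (eventually_gt_atTop i)] with k hk hki
        exact (admissible_iff.mp hk.1).1 i hki
      rw [sub_zero] at h
      simpa [DenseSequence.basicBall] using h
    refine ⟨hA', le_antisymm ?_ (Metric.infDist_le_dist_of_mem hA')⟩
    have h : dist (curvePoint n t) x ≤ dist x a :=
      le_of_tendsto_of_tendsto (hY.dist tendsto_const_nhds) (hlim.comp hφ')
        (hφ'.eventually (hopt.mono fun k hk => hk.2))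
    rw [dist_comm] at h
    exact h.trans (le_of_eq hdist)

end Projection

theorem mainTheorem2 (n : ℕ) (hn : 2 ≤ n) :
    StrongWeihrauchEquiv (projNeg (euclideanSeq n)) (BWT realSeq) :=
  ⟨projNeg_reducible_bwt n, bwt_reducible_projNeg hn⟩
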